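/- Let $n,k$ be integers with $1\le k\le n-k$ and let $\mathfrak g=\mathfrak{sl}_n(\mathbb C)$, with Cartan subalgebra $\mathfrak h$ of diagonal matrices, upper triangular positive root vectors, and fundamental weights $\omega_1,\dots,\omega_{n-1}$. For a weight $\lambda\in\mathfrak h^*$ let $V_\lambda$ be the irreducible $\mathfrak g$-module of highest weight $\lambda$ (the irreducible quotient of the Verma module) and $\pi_\lambda:U(\mathfrak g)\to\operatorname{End}V_\lambda$ the corresponding representation. Put $X_{ij}=E_{ij}$ for $i\ne j$, $X_{ii}=E_{ii}-\frac1n\sum_{m=1}^nE_{mm}$, and for $p\geq 2$ $$\mathfrak C_p=\sum_{i_1,\dots,i_p=1}^nX_{i_1i_2}X_{i_2i_3}\cdots X_{i_pi_1}\in U(\mathfrak g).$$ For $z$ in the centre of $U(\mathfrak g)$ let $$M_{\lambda,\nu}(z)=\delta_{\lambda,\nu}(z)-\pi_\lambda(z)\otimes\mathrm{id}-\mathrm{id}\otimes\pi_\nu(z)\in\operatorname{End}(V_\lambda\otimes V_\nu),$$ where $\delta_{\lambda,\nu}$ is the action of $U(\mathfrak g)$ on the tensor product module, i.e. the algebra homomorphism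 with $\delta_{\lambda,\nu}(x)=\pi_\lambda(x)\otimes\mathrm{id}+\mathrm{id}\otimes\pi_\nu(x)$ for $x\in\mathfrak g$. A $\mathfrak g$-module $T$ is said to be separated by linear operators $D_1,\dots,D_m$ on $T$ if $T=\bigoplus_{i=1}^sW_i$ with irreducible submodules $W_i$, each $D_j$ acts on each $W_i$ by a scalar $a_{ij}$, and for all $i\ne i'$ there is a $j$ with $a_{ij}\ne a_{i'j}$. Then there is a dominant integral weight $\nu$ such that $\omega_k$ is totally subordinate to $\nu$, i.e. the number of irreducible constituents of $V_{\omega_k}\otimes V_\nu$ equals $\dim V_{\omega_k}$, and such that $V_{\omega_k}\otimes V_\nu$ is separated by the operators $M_{\omega_k,\nu}(\mathfrak C_2),\dots,M_{\omega_k,\nu}(\mathfrak C_{k+1})$. -/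

import Mathlib

open scoped TensorProduct

noncomputable section

namespace SLTensor

/-- The Lie algebra `sl_n(ℂ)` of traceless complex `n × n` matrices. -/
abbrev 𝔰𝔩 (n : ℕ) : Type := LieAlgebra.SpecialLinear.sl (Fin n) ℂ

/-- The universal enveloping algebra `U(sl_n(ℂ))`. -/
abbrev Env (n : ℕ) : Type := UniversalEnvelopingAlgebra ℂ (𝔰𝔩 n)

/-- The matrix `E_ij - δ_ij (1/n) I`. -/
def XMat (n : ℕ) (i j : Fin n) : Matrix (Fin n) (Fin n) ℂ :=
  Matrix.single i j 1 - if i = j then (1 / (n : ℂ)) • (1 : Matrix (Fin n) (Fin n) ℂ) else 0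

theorem XMat_mem (n : ℕ) (i j : Fin n) : XMat n i j ∈ LieAlgebra.SpecialLinear.sl (Fin n) ℂ := by
  have hn : (n : ℂ) ≠ 0 := by
    have := i.pos
    exact_mod_cast this.ne'
  change (XMat n i j).trace = 0
  unfold XMat
  by_cases h : i = j
  · subst h
    simp [hn]
  · simp [h, Matrix.trace_single_eq_of_ne]

/-- The elements `X_ij` of `sl_n(ℂ)`: `X_ij = E_ij` for `i ≠ j`, `X_ii = E_ii - (1/n) I`. -/
def X (n : ℕ) (i j : Fin n) : 𝔰𝔩 n := ⟨XMat n i j, XMat_mem n i j⟩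

/-- The Cartan subalgebra `𝔥` of diagonal matrices in `sl_n(ℂ)`. -/
def cartan (n : ℕ) : Submodule ℂ (𝔰𝔩 n) where
  carrier := {x | ∀ i j : Fin n, i ≠ j → (x : Matrix (Fin n) (Fin n) ℂ) i j = 0}
  add_mem' := by
    intro a b ha hb i j hij
    simp [ha i j hij, hb i j hij]
  zero_mem' := by
    intro i j _
    simp
  smul_mem' := by
    intro c a ha i j hij
    simp [ha i j hij]

/-- Weights: elements of `𝔥*`. -/
abbrev Weight (n : ℕ) : Type := Module.Dual ℂ (cartan n)

theorem X_diag_mem (n : ℕ) (i : Fin n) : X n i i ∈ cartan n := by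
  intro a b hab
  simp only [X, XMat, if_true, Matrix.sub_apply, Matrix.smul_apply, Matrix.one_apply_ne hab,
    smul_zero, sub_zero]
  rw [Matrix.single_apply, if_neg]
  rintro ⟨rfl, rfl⟩
  exact hab rfl

/-- The diagonal elements `X_ii`, as elements of `𝔥`. -/
def XDiag (n : ℕ) (i : Fin n) : cartan n := ⟨X n i i, X_diag_mem n i⟩

/-- The fundamental weight `ω_k`: it sends `diag(x_1, …, x_n)` to `x_1 + ⋯ + x_k`, so that on the
simple coroots `h_j = X_jj - X_{j+1,j+1}` it takes the values `ω_k (h_j) = δ_kj`. -/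
def fundWeight (n k : ℕ) : Weight n where
  toFun h := ∑ i ∈ Finset.univ.filter (fun i : Fin n => (i : ℕ) < k),
    ((h : 𝔰𝔩 n) : Matrix (Fin n) (Fin n) ℂ) i i
  map_add' a b := by simp [Finset.sum_add_distrib]
  map_smul' c a := by simp [Finset.mul_sum]

/-- Dominant integral weights: the value on each simple coroot `X_ii - X_{i+1,i+1}` is a
non-negative integer. -/
def IsDominant {n : ℕ} (ν : Weight n) : Prop :=
  ∀ i j : Fin n, (j : ℕ) = i + 1 → ∃ a : ℕ, ν (XDiag n i - XDiag n j) = a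

/-- The left ideal of `U(sl_n)` generated by the positive root vectors `X_ij`, `i < j`, and by
`h - ν(h)`, `h ∈ 𝔥`. -/
def vermaIdeal {n : ℕ} (ν : Weight n) : Submodule (Env n) (Env n) :=
  Submodule.span (Env n)
    ({u | ∃ i j : Fin n, i < j ∧ u = UniversalEnvelopingAlgebra.ι ℂ (X n i j)} ∪
      {u | ∃ h : cartan n,
        u = UniversalEnvelopingAlgebra.ι ℂ (h : 𝔰𝔩 n) - algebraMap ℂ (Env n) (ν h)})

/-- The Verma module of highest weight `ν`. -/
abbrev Verma {n : ℕ} (ν : Weight n) : Type := Env n ⧸ vermaIdeal ν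

/-- The maximal proper submodule of the Verma module: the sum of all proper submodules. -/
def vermaRadical {n : ℕ} (ν : Weight n) : Submodule (Env n) (Verma ν) :=
  sSup {N : Submodule (Env n) (Verma ν) | N ≠ ⊤}

/-- The irreducible module `V_ν` of highest weight `ν`: the irreducible quotient of the Verma
module. -/
def V {n : ℕ} (ν : Weight n) : Type := Verma ν ⧸ vermaRadical ν

instance {n : ℕ} (ν : Weight n) : AddCommGroup (V ν) :=
  inferInstanceAs (AddCommGroup (Verma ν ⧸ vermaRadical ν))

instance {n : ℕ} (ν : Weight n) : Module (Env n) (V ν) :=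
  inferInstanceAs (Module (Env n) (Verma ν ⧸ vermaRadical ν))

instance {n : ℕ} (ν : Weight n) : Module ℂ (V ν) :=
  inferInstanceAs (Module ℂ (Verma ν ⧸ vermaRadical ν))

instance {n : ℕ} (ν : Weight n) : IsScalarTower ℂ (Env n) (V ν) :=
  inferInstanceAs (IsScalarTower ℂ (Env n) (Verma ν ⧸ vermaRadical ν))

/-- `sl_n` acts on `V_ν` through its inclusion in the enveloping algebra. -/
instance {n : ℕ} (ν : Weight n) : LieRingModule (𝔰𝔩 n) (V ν) where
  bracket x v := UniversalEnvelopingAlgebra.ι ℂ x • v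
  add_lie x y v := by simp [add_smul]
  lie_add x v w := by simp
  leibniz_lie x y v := by
    simp [LieRing.of_associative_ring_bracket, sub_smul, mul_smul]

instance {n : ℕ} (ν : Weight n) : LieModule ℂ (𝔰𝔩 n) (V ν) where
  smul_lie c x v := by
    change UniversalEnvelopingAlgebra.ι ℂ (c • x) • v = c • (UniversalEnvelopingAlgebra.ι ℂ x • v)
    simp
  lie_smul c x v := smul_algebra_smul_comm c (UniversalEnvelopingAlgebra.ι ℂ x) v

/-- The action of the enveloping algebra on a Lie module. -/
def envAction (n : ℕ) (T : Type) [AddCommGroup T] [Module ℂ T] [LieRingModule (𝔰𝔩 n) T]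
    [LieModule ℂ (𝔰𝔩 n) T] : Env n →ₐ[ℂ] Module.End ℂ T :=
  UniversalEnvelopingAlgebra.lift ℂ (LieModule.toEnd ℂ (𝔰𝔩 n) T)

/-- The Casimir element
`C_p = ∑_{i_1, …, i_p} X_{i_1 i_2} X_{i_2 i_3} ⋯ X_{i_p i_1}`, that is, the trace of the `p`-th power
of the matrix `(X_ij)` over `U(sl_n)`. -/
def casimir (n p : ℕ) : Env n :=
  ((Matrix.of fun i j : Fin n => UniversalEnvelopingAlgebra.ι ℂ (X n i j)) ^ p).trace

/-- The operator `M_{l,ν}(z) = δ_{l,ν}(z) - π_l(z) ⊗ id - id ⊗ π_ν(z)` on `V_l ⊗ V_ν`, where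
`δ_{l,ν}` is the action of the enveloping algebra on the tensor product module. -/
def M {n : ℕ} (l ν : Weight n) (z : Env n) : Module.End ℂ (V l ⊗[ℂ] V ν) :=
  envAction n (V l ⊗[ℂ] V ν) z
    - TensorProduct.map (envAction n (V l) z) LinearMap.id
    - TensorProduct.map LinearMap.id (envAction n (V ν) z)

/-- A decomposition of an `sl_n`-module as a finite direct sum of irreducible submodules. -/
structure IsIrreducibleDecomposition {n : ℕ} {T : Type} [AddCommGroup T] [Module ℂ T]
    [LieRingModule (𝔰𝔩 n) T] [LieModule ℂ (𝔰𝔩 n) T] {s : ℕ}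
    (W : Fin s → LieSubmodule ℂ (𝔰𝔩 n) T) : Prop where
  irreducible : ∀ i, LieModule.IsIrreducible ℂ (𝔰𝔩 n) (W i)
  isInternal : DirectSum.IsInternal fun i => (W i).toSubmodule

/-- `l` is totally subordinate to `ν`: the number of irreducible constituents of `V_l ⊗ V_ν` is
the dimension of `V_l`. -/
def TotallySubordinate {n : ℕ} (l ν : Weight n) : Prop :=
  ∃ W : Fin (Module.finrank ℂ (V l)) → LieSubmodule ℂ (𝔰𝔩 n) (V l ⊗[ℂ] V ν),
    IsIrreducibleDecomposition W

/-- The module `T` is separated by the operators `D_j`: `T` is a direct sum of irreducible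
submodules `W_i`, every `D_j` acts on every `W_i` by a scalar `a_ij`, and for any two different
constituents some `D_j` acts on them by different scalars. -/
def SeparatedBy (n : ℕ) {T : Type} [AddCommGroup T] [Module ℂ T]
    [LieRingModule (𝔰𝔩 n) T] [LieModule ℂ (𝔰𝔩 n) T] {κ : Type} (D : κ → Module.End ℂ T) : Prop :=
  ∃ (s : ℕ) (W : Fin s → LieSubmodule ℂ (𝔰𝔩 n) T) (a : Fin s → κ → ℂ),
    IsIrreducibleDecomposition W ∧
    (∀ i j, ∀ v ∈ W i, D j v = a i j • v) ∧
    ∀ i i', i ≠ i' → ∃ j, a i j ≠ a i' j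

end SLTensor

end

/-! The quadratic Casimir alone separates the tensor product for a suitable ν, and p = 2 lies in the
allowed range because k ≥ 1. The weights γ of V_{ω_k} = Λ^k ℂ^n have multiplicity one and correspond
to the k-element sets S of indices. For the ν chosen here there is one constituent of highest weight
ν + γ for each γ. All γ have the same length, so the Casimir value on it is 2⟨ν + ρ, γ⟩ up to a
constant. Take ν = ∑ (2^{n-m} - 1) ω_m. Then, with indices from 0, ν + ρ has coordinates 2^{n-i} up
to a common constant, and the value is 2 ∑_{i ∈ S} 2^{n-i} plus a constant. Uniqueness of binary
expansions makes these values different.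

The constituents are counted through the coinvariants T / 𝔫⁻T of T = V_{ω_k} ⊗ V_ν. They are spanned
by the classes of x ⊗ v_ν (`span_tmul_sup_lowered`), on which C_2 acts through the Cartan subalgebra
with the values above (`casimir_two_tmul`). The classes are nonzero because they pair nontrivially
with explicit singular vectors (`pair_detVec_sum`). So C_2 has simple spectrum on the coinvariants.
Given complete reducibility and the fact that a nonzero submodule has nonzero coinvariants, each
C_2-eigenspace of T is irreducible and there are dim V_{ω_k} of them (the lemmas on
`SimpleCoinvariants`).

Both properties come from a concrete model. V_{ω_k} and V_ν embed in tensor powers of ℂ^n, realised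
as functions on multi-indices, with a product of determinants as highest weight vector. The
Hermitian form there is contravariant, so the radical of the Verma module is exactly the kernel of
the map to the model (`vermaRadical_eq_ker`), and orthogonal complements of submodules are
submodules. Negative root vectors raise the sum of the indices, which forces nonzero coinvariants.
-/

noncomputable section

namespace SLTensor

/-! ### Decomposing a module by an operator with simple spectrum on coinvariants -/

section Decomposition

set_option linter.unusedSectionVars false

variable {L T : Type*} [LieRing L] [LieAlgebra ℂ L] [AddCommGroup T] [Module ℂ T]
  [LieRingModule L T] [LieModule ℂ L T]

/-- The span of the vectors `⁅f, t⁆` with `f ∈ F` and `t ∈ N`. -/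
def lowered (F : Set L) (N : LieSubmodule ℂ L T) : Submodule ℂ T :=
  Submodule.span ℂ {y | ∃ f ∈ F, ∃ t ∈ N, y = ⁅f, t⁆}

theorem lie_mem_lowered {F : Set L} {N : LieSubmodule ℂ L T} {f : L} (hf : f ∈ F) {t : T}
    (ht : t ∈ N) : ⁅f, t⁆ ∈ lowered F N :=
  Submodule.subset_span ⟨f, hf, t, ht, rfl⟩

theorem lowered_le (F : Set L) (N : LieSubmodule ℂ L T) : lowered F N ≤ N.toSubmodule := by
  refine Submodule.span_le.2 ?_
  rintro _ ⟨f, -, t, ht, rfl⟩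
  exact N.lie_mem ht

theorem lowered_mono (F : Set L) {N N' : LieSubmodule ℂ L T} (h : N ≤ N') :
    lowered F N ≤ lowered F N' := by
  refine Submodule.span_mono ?_
  rintro _ ⟨f, hf, t, ht, rfl⟩
  exact ⟨f, hf, t, h ht, rfl⟩

theorem lowered_top_le_sup (F : Set L) {N N' : LieSubmodule ℂ L T} (h : IsCompl N N') :
    lowered F (⊤ : LieSubmodule ℂ L T) ≤ lowered F N ⊔ lowered F N' := by
  refine Submodule.span_le.2 ?_
  rintro _ ⟨f, hf, t, -, rfl⟩
  have ht : t ∈ N ⊔ N' := by rw [h.sup_eq_top]; trivial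
  obtain ⟨a, ha, b, hb, rfl⟩ := (LieSubmodule.mem_sup _ _ _).1 ht
  rw [lie_add]
  exact Submodule.add_mem_sup (lie_mem_lowered hf ha) (lie_mem_lowered hf hb)

/-- Taking coinvariants is additive: F T is the sum of F N and F N', so membership in it can be
tested on each summand. -/
theorem mem_lowered_of_mem_of_isCompl (F : Set L) {N N' : LieSubmodule ℂ L T} (h : IsCompl N N')
    {t t' : T} (ht : t ∈ N) (ht' : t' ∈ N')
    (hl : t + t' ∈ lowered F (⊤ : LieSubmodule ℂ L T)) : t ∈ lowered F N := by
  obtain ⟨a, ha, b, hb, hab⟩ := Submodule.mem_sup.1 (lowered_top_le_sup F h hl)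
  have haN := lowered_le F N ha
  have hbN := lowered_le F N' hb
  have h0 : t - a ∈ N ⊓ N' := by
    refine (LieSubmodule.mem_inf ..).2 ⟨N.sub_mem ht haN, ?_⟩
    have : t - a = b - t' := by rw [sub_eq_sub_iff_add_eq_add, ← hab, add_comm]
    rw [this]
    exact N'.sub_mem hbN ht'
  rw [h.inf_eq_bot, LieSubmodule.mem_bot, sub_eq_zero] at h0
  rwa [h0]

/-- The eigenspace of an operator commuting with the Lie algebra, as a submodule. -/
def eigenLieSubmodule (C : Module.End ℂ T) (hC : ∀ (x : L) (t : T), C ⁅x, t⁆ = ⁅x, C t⁆) (μ : ℂ) :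
    LieSubmodule ℂ L T where
  toSubmodule := C.eigenspace μ
  lie_mem := by
    intro x t ht
    have ht' : C t = μ • t := Module.End.mem_eigenspace_iff.1 ht
    refine Module.End.mem_eigenspace_iff.2 ?_
    rw [hC, ht', lie_smul]

theorem mem_eigenLieSubmodule {C : Module.End ℂ T} {hC : ∀ (x : L) (t : T), C ⁅x, t⁆ = ⁅x, C t⁆}
    {μ : ℂ} {t : T} : t ∈ eigenLieSubmodule C hC μ ↔ C t = μ • t :=
  Module.End.mem_eigenspace_iff

/-- Schur's lemma. -/
theorem exists_scalar_of_isIrreducible [FiniteDimensional ℂ T] [LieModule.IsIrreducible ℂ L T]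
    (C : Module.End ℂ T) (hC : ∀ (x : L) (t : T), C ⁅x, t⁆ = ⁅x, C t⁆) :
    ∃ c : ℂ, ∀ t, C t = c • t := by
  have : Nontrivial T := LieModule.nontrivial_of_isIrreducible ℂ L T
  obtain ⟨c, hc⟩ := Module.End.exists_eigenvalue C
  refine ⟨c, fun t => ?_⟩
  obtain ⟨y, hy, hy0⟩ := hc.exists_hasEigenvector
  have : eigenLieSubmodule C hC c = ⊤ := by
    refine (eq_bot_or_eq_top (eigenLieSubmodule C hC c)).resolve_left fun h => hy0 ?_
    have hy' : y ∈ eigenLieSubmodule C hC c := hy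
    rwa [h, LieSubmodule.mem_bot] at hy'
  have ht : t ∈ eigenLieSubmodule C hC c := by rw [this]; trivial
  exact mem_eigenLieSubmodule.1 ht

theorem exists_scalar_on_of_isIrreducible [FiniteDimensional ℂ T] (W : LieSubmodule ℂ L T)
    [LieModule.IsIrreducible ℂ L W] (C : Module.End ℂ T)
    (hC : ∀ (x : L) (t : T), C ⁅x, t⁆ = ⁅x, C t⁆) (hW : ∀ t ∈ W, C t ∈ W) :
    ∃ c : ℂ, ∀ t ∈ W, C t = c • t := by
  obtain ⟨c, hc⟩ := exists_scalar_of_isIrreducible (L := L) (T := W)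
    (LinearMap.restrict C (p := W.toSubmodule) (q := W.toSubmodule) hW)
    (fun x t => Subtype.ext (hC x t))
  exact ⟨c, fun t ht => congrArg Subtype.val (hc ⟨t, ht⟩)⟩

theorem lowered_le_comap (F : Set L) (C : Module.End ℂ T)
    (hC : ∀ (x : L) (t : T), C ⁅x, t⁆ = ⁅x, C t⁆) : lowered F (⊤ : LieSubmodule ℂ L T) ≤
    (lowered F (⊤ : LieSubmodule ℂ L T)).comap C := by
  refine Submodule.span_le.2 ?_
  rintro _ ⟨f, hf, t, -, rfl⟩
  simp only [Submodule.comap_coe, Set.mem_preimage, hC, SetLike.mem_coe]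
  exact lie_mem_lowered hf trivial

/-- The operator induced on the coinvariants. -/
def coinvMap (F : Set L) (C : Module.End ℂ T)
    (hC : ∀ (x : L) (t : T), C ⁅x, t⁆ = ⁅x, C t⁆) :
    Module.End ℂ (T ⧸ lowered F (⊤ : LieSubmodule ℂ L T)) :=
  Submodule.mapQ _ _ C (lowered_le_comap F C hC)

/-- The operator `C` acts on the coinvariants `T / F T` with simple spectrum: the classes of the
`x j` span the coinvariants and are eigenvectors for the different eigenvalues `c j`. Moreover `T`
is completely reducible and every nonzero submodule has nonzero coinvariants. -/
structure SimpleCoinvariants (F : Set L) (C : Module.End ℂ T) {J : Type*} (x : J → T) (c : J → ℂ) :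
    Prop where
  exists_isCompl : ∀ N : LieSubmodule ℂ L T, ∃ N', IsCompl N N'
  eq_bot : ∀ N : LieSubmodule ℂ L T, N.toSubmodule ≤ lowered F N → N = ⊥
  comm : ∀ (y : L) (t : T), C ⁅y, t⁆ = ⁅y, C t⁆
  mem : ∀ (N : LieSubmodule ℂ L T), ∀ t ∈ N, C t ∈ N
  injective : Function.Injective c
  span : Submodule.span ℂ (Set.range x) ⊔ lowered F (⊤ : LieSubmodule ℂ L T) = ⊤
  eigen : ∀ j, C (x j) - c j • x j ∈ lowered F (⊤ : LieSubmodule ℂ L T)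
  notMem : ∀ j, x j ∉ lowered F (⊤ : LieSubmodule ℂ L T)

namespace SimpleCoinvariants

variable {F : Set L} {C : Module.End ℂ T} {J : Type*} {x : J → T} {c : J → ℂ}

theorem hasEigenvector_coinvMap (H : SimpleCoinvariants F C x c) (j : J) :
    (coinvMap F C H.comm).HasEigenvector (c j) (Submodule.Quotient.mk (x j)) := by
  refine ⟨Module.End.mem_eigenspace_iff.2 ?_,
    fun h => H.notMem j ((Submodule.Quotient.mk_eq_zero _).1 h)⟩
  rw [coinvMap, Submodule.mapQ_apply, ← Submodule.Quotient.mk_smul, Submodule.Quotient.eq]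
  exact H.eigen j

/-- A vector t of E outside F E also lies outside F T, since E has a complement. Expand its class in
the independent eigenvectors `x j`. Applying C - μ kills the class, so only the index with c j = μ
can occur, and injectivity of c leaves a single term. -/
theorem exists_leading_term (H : SimpleCoinvariants F C x c) (E : LieSubmodule ℂ L T)
    (hE : E ≠ ⊥) (μ : ℂ)
    (hEμ : ∀ t ∈ E, C t = μ • t) :
    ∃ j, c j = μ ∧ ∃ t ∈ E, t ∉ lowered F (⊤ : LieSubmodule ℂ L T) ∧
      ∃ a : ℂ, a ≠ 0 ∧ t - a • x j ∈ lowered F (⊤ : LieSubmodule ℂ L T) := by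
  obtain ⟨t, htE, htl⟩ : ∃ t ∈ E, t ∉ lowered F E := by
    by_contra! h
    exact hE (H.eq_bot E h)
  obtain ⟨E', hE'⟩ := H.exists_isCompl E
  have htl' : t ∉ lowered F (⊤ : LieSubmodule ℂ L T) := fun h =>
    htl (mem_lowered_of_mem_of_isCompl F hE' htE E'.zero_mem (by simpa using h))
  have ht : t ∈ Submodule.span ℂ (Set.range x) ⊔ lowered F (⊤ : LieSubmodule ℂ L T) := by
    rw [H.span]; trivial
  obtain ⟨y, hy, z, hz, hyz⟩ := Submodule.mem_sup.1 ht
  obtain ⟨a, rfl⟩ := (Finsupp.mem_span_range_iff_exists_finsupp).1 hy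
  have hli := Module.End.eigenvectors_linearIndependent' (coinvMap F C H.comm) c H.injective
    (fun j => Submodule.Quotient.mk (x j)) (H.hasEigenvector_coinvMap)
  have hmk : (Submodule.Quotient.mk t : T ⧸ lowered F (⊤ : LieSubmodule ℂ L T))
      = a.sum fun j r => r • Submodule.Quotient.mk (x j) := by
    rw [← hyz, Submodule.Quotient.mk_add, (Submodule.Quotient.mk_eq_zero _).2 hz, add_zero]
    simp only [Finsupp.sum, ← Submodule.mkQ_apply, map_sum, map_smul]
  have hC0 : (a.sum fun j r => (r * (c j - μ)) •
      (Submodule.Quotient.mk (x j) : T ⧸ lowered F (⊤ : LieSubmodule ℂ L T))) = 0 := by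
    have h1 : coinvMap F C H.comm (Submodule.Quotient.mk t) = μ • Submodule.Quotient.mk t := by
      rw [coinvMap, Submodule.mapQ_apply, hEμ t htE, Submodule.Quotient.mk_smul]
    rw [hmk] at h1
    simp only [Finsupp.sum, map_sum, map_smul, Finset.smul_sum] at h1 ⊢
    rw [← sub_eq_zero, ← Finset.sum_sub_distrib] at h1
    rw [← h1]
    refine Finset.sum_congr rfl fun j _ => ?_
    rw [Module.End.mem_eigenspace_iff.1 (H.hasEigenvector_coinvMap j).1]
    module
  have ha : ∀ j, a j ≠ 0 → c j = μ := by
    intro j hj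
    have := linearIndependent_iff'.1 hli a.support (fun j => a j * (c j - μ)) hC0 j
      (Finsupp.mem_support_iff.2 hj)
    rcases mul_eq_zero.1 this with h | h
    · exact absurd h hj
    · exact sub_eq_zero.1 h
  obtain ⟨j, hj⟩ : ∃ j, a j ≠ 0 := by
    by_contra! h
    have : a = 0 := Finsupp.ext h
    rw [this] at hyz
    simp only [Finsupp.sum_zero_index, zero_add] at hyz
    exact htl' (hyz ▸ hz)
  refine ⟨j, ha j hj, t, htE, htl', a j, hj, ?_⟩
  have : (a.sum fun i r => r • x i) = a j • x j := by
    refine Finset.sum_eq_single j (fun i hi hij => ?_) fun h => ?_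
    · exact absurd (H.injective ((ha i (Finsupp.mem_support_iff.1 hi)).trans (ha j hj).symm)) hij
    · simp [Finsupp.notMem_support_iff.1 h]
  rw [← hyz, this, add_sub_cancel_left]
  exact hz

/-- If C - c j were injective on T, it would be surjective by finite dimension. It would then be
surjective, hence injective, on the coinvariants, where it kills the class of `x j`. -/
theorem eigenLieSubmodule_ne_bot [FiniteDimensional ℂ T] (H : SimpleCoinvariants F C x c)
    (j : J) : eigenLieSubmodule C H.comm (c j) ≠ ⊥ := by
  intro h
  have hinj : Function.Injective (C - algebraMap ℂ (Module.End ℂ T) (c j)) := by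
    refine (injective_iff_map_eq_zero _).2 fun t ht => ?_
    have : t ∈ eigenLieSubmodule C H.comm (c j) := by
      rw [mem_eigenLieSubmodule]
      simpa [sub_eq_zero] using ht
    rwa [h, LieSubmodule.mem_bot] at this
  have hsurj := LinearMap.surjective_of_injective hinj
  have hsurj' : Function.Surjective (coinvMap F C H.comm - algebraMap ℂ
      (Module.End ℂ (T ⧸ lowered F (⊤ : LieSubmodule ℂ L T))) (c j)) := by
    intro y
    obtain ⟨y, rfl⟩ := Submodule.Quotient.mk_surjective _ y
    obtain ⟨t, rfl⟩ := hsurj y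
    refine ⟨Submodule.Quotient.mk t, ?_⟩
    simp [coinvMap]
  have hinj' := LinearMap.injective_iff_surjective.2 hsurj'
  have he := H.hasEigenvector_coinvMap j
  refine he.2 (hinj' ?_)
  rw [map_zero, LinearMap.sub_apply, Module.End.mem_eigenspace_iff.1 he.1]
  simp

/-- The coinvariants have room for only one class with eigenvalue c j. Two complementary nonzero
pieces N₁ and R ⊓ W of the eigenspace would both have a multiple of it as leading term. A suitable
combination would then lie in F T, and splitting along N₁ ⊕ R would put the vector of N₁ in F T as
well. -/
theorem isIrreducible_eigenLieSubmodule [FiniteDimensional ℂ T] (H : SimpleCoinvariants F C x c)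
    (j : J) :
    LieModule.IsIrreducible ℂ L (eigenLieSubmodule C H.comm (c j)) := by
  set W := eigenLieSubmodule C H.comm (c j) with hW
  have : Nontrivial W :=
    (LieSubmodule.nontrivial_iff_ne_bot ℂ L T).2 (H.eigenLieSubmodule_ne_bot j)
  refine LieModule.IsIrreducible.mk fun N hN => ?_
  by_contra hNtop
  set N₁ : LieSubmodule ℂ L T := N.map W.incl with hN₁
  have hN₁W : N₁ ≤ W := by
    rintro _ ⟨y, -, rfl⟩
    exact y.2
  have hN₁0 : N₁ ≠ ⊥ := by
    intro h
    refine hN (LieSubmodule.eq_bot_iff _ |>.2 fun y hy => ?_)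
    have : (y : T) ∈ N₁ := (LieSubmodule.mem_map _).2 ⟨y, hy, rfl⟩
    rw [h, LieSubmodule.mem_bot] at this
    exact Subtype.ext this
  obtain ⟨R, hR⟩ := H.exists_isCompl N₁
  have hN₂0 : R ⊓ W ≠ ⊥ := by
    intro h
    refine hNtop (eq_top_iff.2 fun y _ => ?_)
    have hy : (y : T) ∈ N₁ ⊔ R := by rw [hR.sup_eq_top]; trivial
    obtain ⟨a, ha, b, hb, hab⟩ := (LieSubmodule.mem_sup _ _ _).1 hy
    have hbW : b ∈ R ⊓ W := by
      refine (LieSubmodule.mem_inf ..).2 ⟨hb, ?_⟩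
      rw [← add_sub_cancel_left a b, hab]
      exact W.sub_mem y.2 (hN₁W ha)
    rw [h, LieSubmodule.mem_bot] at hbW
    rw [hbW, add_zero] at hab
    obtain ⟨y', hy', hyy'⟩ := (LieSubmodule.mem_map _).1 ha
    have : y' = y := Subtype.ext (hyy'.trans hab)
    rwa [← this]
  obtain ⟨i, hi, t, ht, htl, a, ha, hta⟩ := H.exists_leading_term
    N₁ hN₁0 (c j) fun t ht => mem_eigenLieSubmodule.1 (hN₁W ht)
  obtain ⟨i', hi', t', ht', -, a', ha', hta'⟩ := H.exists_leading_term (R ⊓ W) hN₂0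
    (c j) fun t ht => mem_eigenLieSubmodule.1 ((LieSubmodule.mem_inf ..).1 ht).2
  obtain rfl := H.injective hi
  obtain rfl := H.injective hi'
  have hmem : a' • t + -(a • t') ∈ lowered F (⊤ : LieSubmodule ℂ L T) := by
    have := Submodule.sub_mem _ (Submodule.smul_mem _ a' hta) (Submodule.smul_mem _ a hta')
    convert this using 1
    module
  have h1 := mem_lowered_of_mem_of_isCompl F hR (N₁.smul_mem a' ht)
    (R.neg_mem (R.smul_mem a ((LieSubmodule.mem_inf ..).1 ht').1)) hmem
  exact htl (lowered_mono F le_top ((Submodule.smul_mem_iff _ ha').1 h1))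

/-- A nonzero complement K would contain an eigenvector of C. The leading term of that eigenspace
inside K forces its eigenvalue to be some c j, so K would meet the sum of the eigenspaces. -/
theorem iSup_eigenLieSubmodule [FiniteDimensional ℂ T] (H : SimpleCoinvariants F C x c) :
    ⨆ j, eigenLieSubmodule C H.comm (c j) = ⊤ := by
  obtain ⟨K, hK⟩ := H.exists_isCompl (⨆ j, eigenLieSubmodule C H.comm (c j))
  suffices h : K = ⊥ by simpa [h] using hK.sup_eq_top
  by_contra hK0
  have : Nontrivial K := (LieSubmodule.nontrivial_iff_ne_bot ℂ L T).2 hK0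
  obtain ⟨μ, hμ⟩ := Module.End.exists_eigenvalue
    (LinearMap.restrict C (p := K.toSubmodule) (q := K.toSubmodule) (H.mem K))
  obtain ⟨y, hy, hy0⟩ := hμ.exists_hasEigenvector
  have hyμ : C (y : T) = μ • (y : T) :=
    congrArg Subtype.val (Module.End.mem_eigenspace_iff.1 hy)
  have hE : K ⊓ eigenLieSubmodule C H.comm μ ≠ ⊥ := by
    intro h
    have : (y : T) ∈ K ⊓ eigenLieSubmodule C H.comm μ :=
      (LieSubmodule.mem_inf ..).2 ⟨y.2, mem_eigenLieSubmodule.2 hyμ⟩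
    rw [h, LieSubmodule.mem_bot] at this
    exact hy0 (Subtype.ext this)
  obtain ⟨j, rfl, -⟩ := H.exists_leading_term _ hE μ
    fun t ht => mem_eigenLieSubmodule.1 ((LieSubmodule.mem_inf ..).1 ht).2
  refine hE (le_bot_iff.1 ?_)
  rw [← hK.inf_eq_bot, inf_comm]
  exact inf_le_inf_right _ (le_iSup (fun j => eigenLieSubmodule C H.comm (c j)) j)

theorem isInternal_eigenLieSubmodule [FiniteDimensional ℂ T] [DecidableEq J]
    (H : SimpleCoinvariants F C x c) :
    DirectSum.IsInternal fun j => (eigenLieSubmodule C H.comm (c j)).toSubmodule := by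
  refine DirectSum.isInternal_submodule_of_iSupIndep_of_iSup_eq_top
    (C.eigenspaces_iSupIndep.comp H.injective) ?_
  rw [← LieSubmodule.iSup_toSubmodule,
    H.iSup_eigenLieSubmodule]
  rfl

end SimpleCoinvariants

end Decomposition

/-! ### Enveloping algebra and Casimir elements -/

section Enveloping

attribute [local instance] LieRing.ofAssociativeRing

/-- Corestrict ι to S and lift it to U(𝔤) → S. Followed by the inclusion this is the identity on
generators, hence the identity, so every element lies in S. -/
theorem subalgebra_eq_top {n : ℕ} (S : Subalgebra ℂ (Env n))
    (hS : ∀ x : 𝔰𝔩 n, UniversalEnvelopingAlgebra.ι ℂ x ∈ S) : S = ⊤ := by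
  let f : 𝔰𝔩 n →ₗ⁅ℂ⁆ S :=
    { toFun := fun x => ⟨UniversalEnvelopingAlgebra.ι ℂ x, hS x⟩
      map_add' := fun x y => Subtype.ext (map_add _ x y)
      map_smul' := fun a x => Subtype.ext (map_smul _ a x)
      map_lie' := fun {x y} => Subtype.ext (LieHom.map_lie _ x y) }
  have h : S.val.comp (UniversalEnvelopingAlgebra.lift ℂ f) = AlgHom.id ℂ (Env n) := by
    refine UniversalEnvelopingAlgebra.hom_ext ℂ (LieHom.ext fun x => ?_)
    change ((UniversalEnvelopingAlgebra.lift ℂ f (UniversalEnvelopingAlgebra.ι ℂ x) : S) : Env n)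
      = UniversalEnvelopingAlgebra.ι ℂ x
    rw [UniversalEnvelopingAlgebra.lift_ι_apply]
    rfl
  refine eq_top_iff.2 fun u _ => ?_
  have hu := DFunLike.congr_fun h u
  rw [AlgHom.id_apply] at hu
  rw [← hu]
  exact (UniversalEnvelopingAlgebra.lift ℂ f u).2

/-- The elements of the enveloping algebra which map `Q` to itself. -/
def stabilizer {n : ℕ} {M : Type*} [AddCommGroup M] [Module ℂ M] [Module (Env n) M]
    [IsScalarTower ℂ (Env n) M] (Q : Submodule ℂ M) : Subalgebra ℂ (Env n) where
  carrier := {u | ∀ y ∈ Q, u • y ∈ Q}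
  mul_mem' := by
    intro u v hu hv y hy
    rw [mul_smul]
    exact hu _ (hv _ hy)
  add_mem' := by
    intro u v hu hv y hy
    rw [add_smul]
    exact Q.add_mem (hu _ hy) (hv _ hy)
  algebraMap_mem' := by
    intro r y hy
    rw [algebraMap_smul]
    exact Q.smul_mem r hy

theorem smul_mem_of_lie_stable {n : ℕ} {M : Type*} [AddCommGroup M] [Module ℂ M] [Module (Env n) M]
    [IsScalarTower ℂ (Env n) M] (Q : Submodule ℂ M)
    (hQ : ∀ (x : 𝔰𝔩 n), ∀ y ∈ Q, UniversalEnvelopingAlgebra.ι ℂ x • y ∈ Q) (u : Env n) {y : M}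
    (hy : y ∈ Q) : u • y ∈ Q := by
  have : u ∈ stabilizer Q := by
    rw [subalgebra_eq_top (stabilizer Q) hQ]
    trivial
  exact this y hy

theorem XMat_apply {n : ℕ} (i j a b : Fin n) : XMat n i j a b =
    (if i = a ∧ j = b then 1 else 0) - if i = j ∧ a = b then 1 / (n : ℂ) else 0 := by
  unfold XMat
  by_cases h : i = j <;> simp [h, Matrix.single_apply, Matrix.one_apply]

theorem lie_X {n : ℕ} (a b i j : Fin n) : ⁅X n a b, X n i j⁆ =
    (if b = i then X n a j else 0) - (if a = j then X n i b else 0) := by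
  apply Subtype.ext
  have hc : ∀ (p q : Fin n) (A : Matrix (Fin n) (Fin n) ℂ),
      Commute (if p = q then (1 / (n : ℂ)) • (1 : Matrix (Fin n) (Fin n) ℂ) else 0) A := by
    intro p q A
    split_ifs
    · exact (Commute.one_left A).smul_left _
    · exact Commute.zero_left A
  have h1 : ((⁅X n a b, X n i j⁆ : 𝔰𝔩 n) : Matrix (Fin n) (Fin n) ℂ)
      = Matrix.single a b 1 * Matrix.single i j 1 - Matrix.single i j 1 * Matrix.single a b 1 := by
    change XMat n a b * XMat n i j - XMat n i j * XMat n a b = _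
    unfold XMat
    simp only [sub_mul, mul_sub, (hc a b _).eq]
    simp only [(hc i j _).eq]
    abel
  rw [h1]
  have h2 : ((((if b = i then X n a j else 0) - (if a = j then X n i b else 0)) : 𝔰𝔩 n) :
      Matrix (Fin n) (Fin n) ℂ) =
      (if b = i then XMat n a j else 0) - (if a = j then XMat n i b else 0) := by
    split_ifs <;> rfl
  rw [h2]
  by_cases hb : b = i <;> by_cases ha : a = j
  · subst hb ha
    simp [XMat]
  · subst hb
    simp [XMat, ha, Matrix.single_mul_single_of_ne, Ne.symm ha]
  · subst ha
    simp [XMat, hb, Matrix.single_mul_single_of_ne, Ne.symm hb]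
  · simp [ha, hb, Matrix.single_mul_single_of_ne, Ne.symm ha]

theorem eq_sum_X {n : ℕ} (x : 𝔰𝔩 n) :
    x = ∑ i, ∑ j, (x : Matrix (Fin n) (Fin n) ℂ) i j • X n i j := by
  apply Subtype.ext
  have htr : ∑ i, (x : Matrix (Fin n) (Fin n) ℂ) i i = 0 := x.2
  have : ((∑ i, ∑ j, (x : Matrix (Fin n) (Fin n) ℂ) i j • X n i j : 𝔰𝔩 n) :
      Matrix (Fin n) (Fin n) ℂ) = ∑ i, ∑ j, (x : Matrix (Fin n) (Fin n) ℂ) i j • XMat n i j := by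
    simp only [X, AddSubmonoidClass.coe_finsetSum]
    rfl
  rw [this]
  unfold XMat
  simp only [smul_sub, Finset.sum_sub_distrib, smul_ite, smul_zero, Finset.sum_ite_eq,
    Finset.mem_univ, if_true]
  rw [← Finset.sum_smul, htr, zero_smul, sub_zero]
  conv_lhs => rw [Matrix.matrix_eq_sum_single (x : Matrix (Fin n) (Fin n) ℂ)]
  simp [Matrix.smul_single]

theorem sum_X_diag (n : ℕ) : ∑ i, X n i i = 0 := by
  apply Subtype.ext
  ext a b
  have hn : (n : ℂ) ≠ 0 := by exact_mod_cast a.pos.ne'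
  simp only [X, AddSubmonoidClass.coe_finsetSum, Matrix.sum_apply, XMat_apply]
  by_cases h : a = b
  · subst h
    simp [hn]
  · simp only [true_and, h, if_false, sub_zero]
    refine Finset.sum_eq_zero fun i _ => if_neg ?_
    rintro ⟨rfl, rfl⟩
    exact h rfl

/-- The bracket of x = X_ab with the entries of the matrix 𝕏 equals the matrix commutator of e =
E_ba with 𝕏. Hence x·1 - e commutes with 𝕏 and with 𝕏^p. In the trace the e-terms cancel, because
the entries of e are central. -/
theorem commute_casimir_X (n p : ℕ) (a b : Fin n) :
    Commute (UniversalEnvelopingAlgebra.ι ℂ (X n a b)) (casimir n p) := by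
  set 𝕏 : Matrix (Fin n) (Fin n) (Env n) :=
    Matrix.of fun i j : Fin n => UniversalEnvelopingAlgebra.ι ℂ (X n i j) with h𝕏
  set x := UniversalEnvelopingAlgebra.ι ℂ (X n a b) with hx
  set e : Matrix (Fin n) (Fin n) (Env n) := Matrix.single b a 1 with he
  have hcomm : Commute (Matrix.diagonal (fun _ => x) - e) 𝕏 := by
    change _ * _ = _ * _
    rw [sub_mul, mul_sub, sub_eq_sub_iff_sub_eq_sub]
    ext i j
    have h := congrArg (UniversalEnvelopingAlgebra.ι ℂ) (lie_X a b i j)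
    rw [LieHom.map_lie, LieRing.of_associative_ring_bracket, map_sub,
      apply_ite (UniversalEnvelopingAlgebra.ι ℂ), apply_ite (UniversalEnvelopingAlgebra.ι ℂ),
      map_zero] at h
    rw [Matrix.sub_apply, Matrix.sub_apply, Matrix.diagonal_mul, Matrix.mul_diagonal]
    refine h.trans ?_
    congr 1
    · by_cases hbi : b = i
      · subst hbi; simp [he, h𝕏]
      · simp [he, hbi, Matrix.single_mul_apply_of_ne _ _ _ _ _ (Ne.symm hbi)]
    · by_cases haj : a = j
      · subst haj; simp [he, h𝕏]
      · simp [he, haj, Matrix.mul_single_apply_of_ne _ _ _ _ _ (Ne.symm haj)]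
  have hp := (hcomm.pow_right p).eq
  rw [sub_mul, mul_sub, sub_eq_sub_iff_sub_eq_sub] at hp
  have ht := congrArg Matrix.trace hp
  rw [Matrix.trace_sub, Matrix.trace_sub] at ht
  have h1 : (e * 𝕏 ^ p).trace = (𝕏 ^ p * e).trace := by
    simp [he, Matrix.trace_single_mul, Matrix.trace_mul_single]
  rw [h1, sub_self, sub_eq_zero] at ht
  change x * (𝕏 ^ p).trace = (𝕏 ^ p).trace * x
  simpa only [Matrix.trace, Matrix.diag_apply, Matrix.diagonal_mul, Matrix.mul_diagonal,
    Finset.mul_sum, Finset.sum_mul] using ht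

theorem commute_casimir (n p : ℕ) (x : 𝔰𝔩 n) :
    Commute (UniversalEnvelopingAlgebra.ι ℂ x) (casimir n p) := by
  rw [eq_sum_X x]
  simp only [map_sum, map_smul]
  exact Commute.sum_left _ _ _ fun i _ => Commute.sum_left _ _ _ fun j _ =>
    (commute_casimir_X n p i j).smul_left _

variable {n : ℕ} {T : Type} [AddCommGroup T] [Module ℂ T] [LieRingModule (𝔰𝔩 n) T]
  [LieModule ℂ (𝔰𝔩 n) T]

theorem envAction_ι (x : 𝔰𝔩 n) (t : T) :
    envAction n T (UniversalEnvelopingAlgebra.ι ℂ x) t = ⁅x, t⁆ := by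
  rw [envAction, UniversalEnvelopingAlgebra.lift_ι_apply]
  rfl

theorem envAction_casimir_lie (p : ℕ) (x : 𝔰𝔩 n) (t : T) :
    envAction n T (casimir n p) ⁅x, t⁆ = ⁅x, envAction n T (casimir n p) t⁆ := by
  rw [← envAction_ι, ← envAction_ι, ← Module.End.mul_apply, ← Module.End.mul_apply, ← map_mul,
    ← map_mul, (commute_casimir n p x).eq]

theorem envAction_mem (N : LieSubmodule ℂ (𝔰𝔩 n) T) (u : Env n) : ∀ t ∈ N,
    envAction n T u t ∈ N := by
  let S : Subalgebra ℂ (Env n) :=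
    { carrier := {u | ∀ t ∈ N, envAction n T u t ∈ N}
      mul_mem' := by
        intro u v hu hv t ht
        rw [map_mul]
        exact hu _ (hv _ ht)
      add_mem' := by
        intro u v hu hv t ht
        rw [map_add]
        exact N.add_mem (hu _ ht) (hv _ ht)
      algebraMap_mem' := by
        intro r t ht
        rw [AlgHom.commutes]
        exact N.smul_mem r ht }
  have hS : S = ⊤ := by
    refine subalgebra_eq_top S fun x t ht => ?_
    rw [envAction_ι]
    exact N.lie_mem ht
  have : u ∈ S := by rw [hS]; trivial
  exact this

/-- The set of negative root vectors. -/
def lowering (n : ℕ) : Set (𝔰𝔩 n) := {f | ∃ i j : Fin n, i < j ∧ f = X n j i}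

theorem sum_filter_lt_sub {M : Type*} [AddCommGroup M] [Module ℂ M] (f : Fin n → M) :
    ∑ i : Fin n, ∑ j : Fin n, (if i < j then f i - f j else 0)
      = ∑ i : Fin n, ((n : ℂ) - 1 - 2 * (i : ℕ)) • f i := by
  have h1 : ∀ i : Fin n, ∑ j : Fin n, (if i < j then f i else 0)
      = ((n : ℂ) - 1 - (i : ℕ)) • f i := by
    intro i
    rw [← Finset.sum_filter, Finset.sum_const, ← Nat.cast_smul_eq_nsmul ℂ]
    congr 1
    have : (Finset.univ.filter fun j : Fin n => i < j) = Finset.Ioi i := by ext; simp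
    rw [this, Fin.card_Ioi]
    have := i.2
    push_cast [Nat.cast_sub (show (i : ℕ) ≤ n - 1 by omega), Nat.cast_sub (show 1 ≤ n by omega)]
    ring
  have h2 : ∀ j : Fin n, ∑ i : Fin n, (if i < j then f j else 0) = ((j : ℕ) : ℂ) • f j := by
    intro j
    rw [← Finset.sum_filter, Finset.sum_const, ← Nat.cast_smul_eq_nsmul ℂ]
    congr 2
    have : (Finset.univ.filter fun i : Fin n => i < j) = Finset.Iio j := by ext; simp
    rw [this, Fin.card_Iio]
  have h3 : ∀ i j : Fin n, (if i < j then f i - f j else 0)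
      = (if i < j then f i else 0) - (if i < j then f j else 0) := by
    intro i j; split_ifs <;> simp
  simp only [h3, Finset.sum_sub_distrib]
  rw [Finset.sum_comm (f := fun i j : Fin n => if i < j then f j else 0)]
  simp only [h1, h2]
  rw [← Finset.sum_sub_distrib]
  refine Finset.sum_congr rfl fun i _ => ?_
  module

/-- The quadratic Casimir element acts on coinvariants through the Cartan subalgebra. -/
theorem envAction_casimir_two_sub_mem (t : T) :
    envAction n T (casimir n 2) t - (∑ i : Fin n, ⁅X n i i, ⁅X n i i, t⁆⁆
      + ∑ i : Fin n, ((n : ℂ) - 1 - 2 * (i : ℕ)) • ⁅X n i i, t⁆)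
      ∈ lowered (lowering n) (⊤ : LieSubmodule ℂ (𝔰𝔩 n) T) := by
  have h1 : envAction n T (casimir n 2) t = ∑ i, ∑ j, ⁅X n i j, ⁅X n j i, t⁆⁆ := by
    simp only [casimir, pow_two, Matrix.trace, Matrix.diag_apply, Matrix.mul_apply,
      Matrix.of_apply, map_sum, map_mul, LinearMap.sum_apply, Module.End.mul_apply, envAction_ι]
  -- Normal ordering: for i < j the negative root vector is moved outermost at the cost of X_ii -
  -- X_jj. These corrections add up to 2ρ, with coordinates n - 1 - 2i for indices counted from 0.
  have h2 : ∀ i j : Fin n, ⁅X n i j, ⁅X n j i, t⁆⁆ =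
      (if i = j then ⁅X n i i, ⁅X n i i, t⁆⁆ else 0)
      + (if i < j then ⁅X n i i, t⁆ - ⁅X n j j, t⁆ else 0)
      + ((if i < j then ⁅X n j i, ⁅X n i j, t⁆⁆ else 0)
        + (if j < i then ⁅X n i j, ⁅X n j i, t⁆⁆ else 0)) := by
    intro i j
    rcases lt_trichotomy i j with h | h | h
    · have := leibniz_lie (X n i j) (X n j i) t
      rw [lie_X] at this
      simp only [if_true, sub_lie] at this
      simp [h, h.ne, h.not_gt, this]
    · subst h; simp
    · simp [h, h.ne', h.not_gt]
  rw [h1]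
  rw [Finset.sum_congr rfl fun i _ => Finset.sum_congr rfl fun j _ => h2 i j]
  simp only [Finset.sum_add_distrib]
  rw [sum_filter_lt_sub (fun i => ⁅X n i i, t⁆)]
  simp only [Finset.sum_ite_eq, Finset.mem_univ, if_true]
  rw [add_sub_cancel_left]
  refine Submodule.add_mem _ ?_ ?_ <;>
  · refine Submodule.sum_mem _ fun i _ => Submodule.sum_mem _ fun j _ => ?_
    split_ifs with h
    · exact lie_mem_lowered (F := lowering n) ⟨_, _, h, rfl⟩ trivial
    · exact Submodule.zero_mem _

end Enveloping

/-! ### Tensor powers of ℂ^n as functions on multi-indices -/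

/-- The tensor power `(ℂ^n)^{⊗ ι}`, as functions on the multi-indices `ι → Fin n`. -/
def Fn (n : ℕ) (ι : Type) : Type := (ι → Fin n) → ℂ

section Model

set_option linter.unusedSectionVars false

variable {n : ℕ} {ι : Type}

instance : AddCommGroup (Fn n ι) := inferInstanceAs (AddCommGroup ((ι → Fin n) → ℂ))

instance : Module ℂ (Fn n ι) := inferInstanceAs (Module ℂ ((ι → Fin n) → ℂ))

theorem Fn.add_apply (F G : Fn n ι) (t : ι → Fin n) : (F + G) t = F t + G t := rfl

theorem Fn.smul_apply (a : ℂ) (F : Fn n ι) (t : ι → Fin n) : (a • F) t = a * F t := rfl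

theorem Fn.zero_apply (t : ι → Fin n) : (0 : Fn n ι) t = 0 := rfl

variable [Fintype ι] [DecidableEq ι]

instance : FiniteDimensional ℂ (Fn n ι) :=
  inferInstanceAs (FiniteDimensional ℂ ((ι → Fin n) → ℂ))

/-- A matrix acting on the tensor factor at position `p`. -/
def site (p : ι) (A : Matrix (Fin n) (Fin n) ℂ) : Module.End ℂ (Fn n ι) where
  toFun F t := ∑ j, A (t p) j * F (Function.update t p j)
  map_add' F G := by
    funext t
    change _ = ∑ j, A (t p) j * F (Function.update t p j)
      + ∑ j, A (t p) j * G (Function.update t p j)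
    simp only [Fn.add_apply, mul_add, Finset.sum_add_distrib]
  map_smul' a F := by
    funext t
    change _ = a * ∑ j, A (t p) j * F (Function.update t p j)
    simp only [Fn.smul_apply, Finset.mul_sum]
    exact Finset.sum_congr rfl fun j _ => by ring

theorem site_apply (p : ι) (A : Matrix (Fin n) (Fin n) ℂ) (F : Fn n ι) (t : ι → Fin n) :
    site p A F t = ∑ j, A (t p) j * F (Function.update t p j) := rfl

theorem site_mul_site (p : ι) (A B : Matrix (Fin n) (Fin n) ℂ) :
    (site p A * site p B : Module.End ℂ (Fn n ι)) = site p (A * B) := by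
  refine LinearMap.ext fun F => funext fun t => ?_
  simp only [Module.End.mul_apply, site_apply, Function.update_self, Function.update_idem,
    Matrix.mul_apply, Finset.sum_mul, Finset.mul_sum]
  rw [Finset.sum_comm]
  simp only [mul_assoc]

theorem commute_site {p q : ι} (h : p ≠ q) (A B : Matrix (Fin n) (Fin n) ℂ) :
    Commute (site p A : Module.End ℂ (Fn n ι)) (site q B) := by
  refine LinearMap.ext fun F => funext fun t => ?_
  simp only [Module.End.mul_apply, site_apply, Function.update_of_ne h,
    Function.update_of_ne h.symm, Finset.mul_sum]
  rw [Finset.sum_comm]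
  refine Finset.sum_congr rfl fun j _ => Finset.sum_congr rfl fun l _ => ?_
  rw [Function.update_comm h]
  ring

/-- The action of matrices on a tensor power. -/
def act : Matrix (Fin n) (Fin n) ℂ →ₗ[ℂ] Module.End ℂ (Fn n ι) where
  toFun A := ∑ p, site p A
  map_add' A B := by
    rw [← Finset.sum_add_distrib]
    refine Finset.sum_congr rfl fun p _ => LinearMap.ext fun F => funext fun t => ?_
    simp only [site_apply, LinearMap.add_apply, Fn.add_apply, Matrix.add_apply, add_mul,
      Finset.sum_add_distrib]
  map_smul' a A := by
    rw [RingHom.id_apply, Finset.smul_sum]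
    refine Finset.sum_congr rfl fun p _ => LinearMap.ext fun F => funext fun t => ?_
    simp only [site_apply, LinearMap.smul_apply, Fn.smul_apply, Matrix.smul_apply, smul_eq_mul,
      Finset.mul_sum, mul_assoc]

theorem Fn.sum_apply {κ : Type*} (s : Finset κ) (F : κ → Fn n ι) (t : ι → Fin n) :
    (∑ i ∈ s, F i) t = ∑ i ∈ s, F i t :=
  Finset.sum_apply t s F

theorem act_eq_sum (A : Matrix (Fin n) (Fin n) ℂ) :
    (act A : Module.End ℂ (Fn n ι)) = ∑ p, site p A := rfl

theorem act_apply (A : Matrix (Fin n) (Fin n) ℂ) (F : Fn n ι) (t : ι → Fin n) :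
    act A F t = ∑ p, ∑ j, A (t p) j * F (Function.update t p j) := by
  rw [act_eq_sum, LinearMap.sum_apply, Fn.sum_apply]
  rfl

theorem act_commutator (A B : Matrix (Fin n) (Fin n) ℂ) :
    (act (A * B - B * A) : Module.End ℂ (Fn n ι)) = act A * act B - act B * act A := by
  rw [map_sub]
  simp only [act_eq_sum, Finset.sum_mul_sum]
  rw [Finset.sum_comm (f := fun p q => site p B * site q A), ← Finset.sum_sub_distrib,
    ← Finset.sum_sub_distrib]
  refine Finset.sum_congr rfl fun p _ => ?_
  rw [← Finset.sum_sub_distrib, Finset.sum_eq_single p]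
  · rw [site_mul_site, site_mul_site]
  · intro q _ hq
    rw [(commute_site hq.symm A B).eq, sub_self]
  · simp

/-- The representation of `sl_n` on a tensor power. -/
def rep (n : ℕ) (ι : Type) [Fintype ι] [DecidableEq ι] :
    letI : LieRing (Module.End ℂ (Fn n ι)) := LieRing.ofAssociativeRing
    𝔰𝔩 n →ₗ⁅ℂ⁆ Module.End ℂ (Fn n ι) :=
  letI : LieRing (Module.End ℂ (Fn n ι)) := LieRing.ofAssociativeRing
  { toFun := fun x => act (x : Matrix (Fin n) (Fin n) ℂ)
    map_add' := fun x y => map_add act (x : Matrix (Fin n) (Fin n) ℂ) y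
    map_smul' := fun a x => map_smul act a (x : Matrix (Fin n) (Fin n) ℂ)
    map_lie' := fun {x y} => act_commutator (x : Matrix (Fin n) (Fin n) ℂ) y }

instance : Module (Env n) (Fn n ι) :=
  Module.compHom _ (UniversalEnvelopingAlgebra.lift ℂ (rep n ι)).toRingHom

theorem ι_smul (x : 𝔰𝔩 n) (F : Fn n ι) :
    UniversalEnvelopingAlgebra.ι ℂ x • F = act (x : Matrix (Fin n) (Fin n) ℂ) F := by
  change (UniversalEnvelopingAlgebra.lift ℂ (rep n ι)) (UniversalEnvelopingAlgebra.ι ℂ x) F = _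
  rw [UniversalEnvelopingAlgebra.lift_ι_apply]
  rfl

instance : IsScalarTower ℂ (Env n) (Fn n ι) where
  smul_assoc a u F := by
    change (UniversalEnvelopingAlgebra.lift ℂ (rep n ι)) (a • u) F
      = a • (UniversalEnvelopingAlgebra.lift ℂ (rep n ι)) u F
    rw [map_smul]
    rfl

theorem act_diagonal {A : Matrix (Fin n) (Fin n) ℂ} (hA : ∀ i j, i ≠ j → A i j = 0) (F : Fn n ι)
    (t : ι → Fin n) : act A F t = (∑ p, A (t p) (t p)) * F t := by
  rw [act_apply, Finset.sum_mul]
  refine Finset.sum_congr rfl fun p _ => ?_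
  rw [Finset.sum_eq_single (t p)]
  · rw [Function.update_eq_self]
  · intro j _ hj
    rw [hA _ _ hj.symm, zero_mul]
  · simp

/-- The standard bilinear pairing on a tensor power. -/
def pair (F G : Fn n ι) : ℂ := ∑ t, F t * G t

/-- Exchanging the summation index j with the entry of t at p is an involution on the pairs (t, j),
and it turns one double sum into the other. -/
theorem pair_site (p : ι) (A : Matrix (Fin n) (Fin n) ℂ) (F G : Fn n ι) :
    pair (site p A F) G = pair F (site p A.transpose G) := by
  simp only [pair, site_apply, Finset.sum_mul, Finset.mul_sum, Matrix.transpose_apply]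
  rw [← Fintype.sum_prod_type', ← Fintype.sum_prod_type']
  let e : ((ι → Fin n) × Fin n) → ((ι → Fin n) × Fin n) :=
    fun x => (Function.update x.1 p x.2, x.1 p)
  have he : Function.Involutive e := by
    rintro ⟨t, j⟩
    simp [e]
  refine Fintype.sum_equiv he.toPerm _ _ ?_
  rintro ⟨t, j⟩
  simp only [Function.Involutive.coe_toPerm, e, Function.update_self, Function.update_idem,
    Function.update_eq_self]
  ring

theorem pair_act (A : Matrix (Fin n) (Fin n) ℂ) (F G : Fn n ι) :
    pair (act A F) G = pair F (act A.transpose G) := by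
  simp only [act_eq_sum, LinearMap.sum_apply]
  have h1 : pair (∑ p, site p A F) G = ∑ p, pair (site p A F) G := by
    simp only [pair, Fn.sum_apply, Finset.sum_mul]
    rw [Finset.sum_comm]
  have h2 : pair F (∑ p, site p A.transpose G) = ∑ p, pair F (site p A.transpose G) := by
    simp only [pair, Fn.sum_apply, Finset.mul_sum]
    rw [Finset.sum_comm]
  rw [h1, h2]
  exact Finset.sum_congr rfl fun p _ => pair_site p A F G

theorem pair_add_left (F F' G : Fn n ι) : pair (F + F') G = pair F G + pair F' G := by
  simp [pair, Fn.add_apply, add_mul, Finset.sum_add_distrib]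

theorem pair_smul_left (a : ℂ) (F G : Fn n ι) : pair (a • F) G = a * pair F G := by
  simp [pair, Fn.smul_apply, mul_assoc, Finset.mul_sum]

theorem pair_zero_left (G : Fn n ι) : pair 0 G = 0 := by
  simp [pair, Fn.zero_apply]

theorem pair_smul_right (a : ℂ) (F G : Fn n ι) : pair F (a • G) = a * pair F G := by
  simp only [pair, Fn.smul_apply, Finset.mul_sum]
  exact Finset.sum_congr rfl fun t _ => by ring

/-- The complex conjugate of a tensor. -/
def conj (F : Fn n ι) : Fn n ι := fun t => starRingEnd ℂ (F t)

theorem act_conj (A : Matrix (Fin n) (Fin n) ℂ) (F : Fn n ι) :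
    act A (conj F) = conj (act (A.map (starRingEnd ℂ)) F) := by
  funext t
  simp [act_apply, conj, Matrix.map_apply]

theorem pair_conj_self_eq_zero {F : Fn n ι} (h : pair F (conj F) = 0) : F = 0 := by
  have h1 : ∑ t, ‖F t‖ ^ 2 = 0 := by
    have : ((∑ t, ‖F t‖ ^ 2 : ℝ) : ℂ) = pair F (conj F) := by
      rw [pair, Complex.ofReal_sum]
      refine Finset.sum_congr rfl fun t _ => ?_
      rw [conj, Complex.mul_conj, Complex.normSq_eq_norm_sq]
    exact_mod_cast this.trans h
  funext t
  have := (Finset.sum_eq_zero_iff_of_nonneg fun t _ => by positivity).1 h1 t (Finset.mem_univ t)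
  rw [Fn.zero_apply]
  simpa using this

/-- The product of the determinants of the blocks `π ⁻¹ b`, with columns labelled by `c`. -/
def detVec {B : Type} [DecidableEq B] (π : ι → B) (c : ι → Fin n) : Fn n ι := fun t =>
  (Matrix.of fun p q : ι => if π p = π q ∧ t p = c q then (1 : ℂ) else 0).det

/-- In every block, the labels are different and form an initial segment. -/
structure IsLabelling {B : Type} (π : ι → B) (c : ι → Fin n) : Prop where
  inj : ∀ q q', π q = π q' → c q = c q' → q = q'
  initial : ∀ q, ∀ i ≤ c q, ∃ q', π q' = π q ∧ c q' = i

/-- Acting at position p changes only row p of the matrix M, so the total action is a derivative of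
det M, expressed through the adjugate. On the columns, A acts by right multiplication of M with a
matrix having diagonal entries A (c q) (c q), and the derivative is the trace of that matrix times
det M. -/
theorem act_detVec {B : Type} [DecidableEq B] {π : ι → B} {c : ι → Fin n} (h : IsLabelling π c)
    {A : Matrix (Fin n) (Fin n) ℂ} (hA : ∀ i j, j < i → A i j = 0) :
    act A (detVec π c) = (∑ q, A (c q) (c q)) • detVec π c := by
  funext t
  set M : Matrix ι ι ℂ := Matrix.of fun p q : ι => if π p = π q ∧ t p = c q then (1 : ℂ) else 0
    with hM
  -- Laplace expansion along the replaced row p.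
  have hupd : ∀ p j, detVec π c (Function.update t p j)
      = ∑ q, M.adjugate q p * (if π p = π q ∧ j = c q then (1 : ℂ) else 0) := by
    intro p j
    have h1 : (Matrix.of fun p' q : ι =>
        if π p' = π q ∧ Function.update t p j p' = c q then (1 : ℂ) else 0)
        = M.updateRow p (fun q => if π p = π q ∧ j = c q then (1 : ℂ) else 0) := by
      ext p' q
      by_cases hp : p' = p
      · subst hp; simp
      · simp [hM, hp]
    rw [detVec, h1, ← Matrix.cramer_transpose_apply, Matrix.cramer_eq_adjugate_mulVec,
      ← Matrix.adjugate_transpose]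
    rfl
  -- The new column is a combination of columns of M from the block of q. Upper triangularity admits
  -- only labels t p ≤ c q, and these all occur in the block because its labels form an initial
  -- segment.
  have hz : ∀ q p, (if π p = π q then A (t p) (c q) else 0)
      = ∑ q', M p q' * (if π q' = π q then A (c q') (c q) else 0) := by
    intro q p
    by_cases hex : ∃ q', π q' = π p ∧ c q' = t p
    · obtain ⟨q', hq', hcq'⟩ := hex
      rw [Finset.sum_eq_single q']
      · simp [hM, hq', hcq']
      · intro q'' _ hne
        have : ¬ (π p = π q'' ∧ t p = c q'') := fun hh =>
          hne (h.inj _ _ (hh.1.symm.trans hq'.symm) (hh.2.symm.trans hcq'.symm))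
        simp [hM, this]
      · simp
    · have h0 : ∀ q', M p q' = 0 := fun q' => by
        have : ¬ (π p = π q' ∧ t p = c q') := fun hh => hex ⟨q', hh.1.symm, hh.2.symm⟩
        simp [hM, this]
      simp only [h0, zero_mul, Finset.sum_const_zero]
      split_ifs with hpq
      · refine hA _ _ (lt_of_not_ge fun hle => hex ?_)
        obtain ⟨q', hq', hcq'⟩ := h.initial q (t p) hle
        exact ⟨q', hq'.trans hpq.symm, hcq'⟩
      · rfl
  have hdet : ∀ q, ∑ p, M.adjugate q p * (if π p = π q then A (t p) (c q) else 0)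
      = A (c q) (c q) * M.det := by
    intro q
    have h1 : M.adjugate.mulVec (M.mulVec fun q' => if π q' = π q then A (c q') (c q) else 0) q
        = A (c q) (c q) * M.det := by
      rw [Matrix.mulVec_mulVec, Matrix.adjugate_mul, Matrix.smul_mulVec, Matrix.one_mulVec]
      simp [mul_comm]
    rw [← h1]
    exact Finset.sum_congr rfl fun p _ => by rw [hz]; rfl
  rw [act_apply, Fn.smul_apply, Finset.sum_mul]
  have hv : detVec π c t = M.det := rfl
  rw [hv]
  simp only [hupd, ← hdet, Finset.mul_sum]
  rw [Finset.sum_congr rfl fun p _ => Finset.sum_comm, Finset.sum_comm]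
  refine Finset.sum_congr rfl fun q _ => Finset.sum_congr rfl fun p _ => ?_
  rw [Finset.sum_eq_single (c q)]
  · split_ifs <;> simp_all [mul_comm]
  · intro j _ hj
    simp [hj]
  · simp

theorem detVec_self {B : Type} [DecidableEq B] {π : ι → B} {c : ι → Fin n} (h : IsLabelling π c) :
    detVec π c c = 1 := by
  have : (Matrix.of fun p q : ι => if π p = π q ∧ c p = c q then (1 : ℂ) else 0) = 1 := by
    ext p q
    by_cases hpq : p = q
    · subst hpq; simp
    · have : ¬ (π p = π q ∧ c p = c q) := fun hh => hpq (h.inj _ _ hh.1 hh.2)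
      simp [hpq, this]
  rw [detVec, this, Matrix.det_one]

theorem conj_detVec {B : Type} [DecidableEq B] (π : ι → B) (c : ι → Fin n) :
    conj (detVec π c) = detVec π c := by
  funext t
  rw [conj, detVec, RingHom.map_det]
  congr 1
  ext p q
  simp [apply_ite]

/-- Strictly lower triangular matrices raise the sum of the indices. -/
theorem act_lower_eq_zero {A : Matrix (Fin n) (Fin n) ℂ} (hA : ∀ i j, i ≤ j → A i j = 0)
    {F : Fn n ι} {m : ℕ} (hF : ∀ t : ι → Fin n, ∑ p, (t p : ℕ) < m → F t = 0) (t : ι → Fin n)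
    (ht : ∑ p, (t p : ℕ) < m + 1) : act A F t = 0 := by
  rw [act_apply]
  refine Finset.sum_eq_zero fun p _ => Finset.sum_eq_zero fun j _ => ?_
  rcases le_or_gt (t p) j with hj | hj
  · rw [hA _ _ hj, zero_mul]
  · rw [hF, mul_zero]
    refine lt_of_lt_of_le (Finset.sum_lt_sum (fun q _ => ?_) ⟨p, Finset.mem_univ p, ?_⟩)
      (Nat.lt_succ_iff.1 ht)
    · by_cases hq : q = p
      · subst hq; simpa using hj.le
      · simp [hq]
    · simpa using hj

end Model

/-! ### Verma modules, their radical, and the embedding of V_ν in a tensor power -/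

section HighestWeight

attribute [local instance] LieRing.ofAssociativeRing

variable {n : ℕ}

/-- `v` is a vector of weight `ν` killed by the positive root vectors. -/
structure IsSingular {M : Type*} [AddCommGroup M] [Module ℂ M] [Module (Env n) M] (ν : Weight n)
    (v : M) : Prop where
  raise : ∀ i j : Fin n, i < j → UniversalEnvelopingAlgebra.ι ℂ (X n i j) • v = 0
  cartan : ∀ h : cartan n, UniversalEnvelopingAlgebra.ι ℂ (h : 𝔰𝔩 n) • v = ν h • v

theorem ι_mul {M : Type*} [AddCommGroup M] [Module (Env n) M] (x y : 𝔰𝔩 n) (m : M) :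
    UniversalEnvelopingAlgebra.ι ℂ x • UniversalEnvelopingAlgebra.ι ℂ y • m
      = UniversalEnvelopingAlgebra.ι ℂ y • UniversalEnvelopingAlgebra.ι ℂ x • m
        + UniversalEnvelopingAlgebra.ι ℂ ⁅x, y⁆ • m := by
  rw [LieHom.map_lie, LieRing.of_associative_ring_bracket, sub_smul, mul_smul, mul_smul]
  abel

/-- A module generated by a singular vector is spanned by the vectors which are obtained from it by
negative root vectors. -/
theorem eq_top_of_lowering_stable {M : Type*} [AddCommGroup M] [Module ℂ M] [Module (Env n) M]
    [IsScalarTower ℂ (Env n) M] {ν : Weight n} {v : M} (hv : IsSingular ν v)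
    (hgen : ∀ y : M, ∃ u : Env n, y = u • v) (Q : Submodule ℂ M) (hvQ : v ∈ Q)
    (hQ : ∀ i j : Fin n, i < j → ∀ y ∈ Q, UniversalEnvelopingAlgebra.ι ℂ (X n j i) • y ∈ Q) :
    Q = ⊤ := by
  set 𝒬 : Set (Submodule ℂ M) := {Q | v ∈ Q ∧
    ∀ i j : Fin n, i < j → ∀ y ∈ Q, UniversalEnvelopingAlgebra.ι ℂ (X n j i) • y ∈ Q} with h𝒬
  set Q₀ := sInf 𝒬 with hQ₀
  have hv₀ : v ∈ Q₀ := Submodule.mem_sInf.2 fun P hP => hP.1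
  have hl₀ : ∀ i j : Fin n, i < j → ∀ y ∈ Q₀,
      UniversalEnvelopingAlgebra.ι ℂ (X n j i) • y ∈ Q₀ := fun i j hij y hy =>
    Submodule.mem_sInf.2 fun P hP => hP.2 i j hij y (Submodule.mem_sInf.1 hy P hP)
  -- Q₁ is closed under a lowering vector f because x f y = f x y + [x, f] y. Minimality of Q₀ then
  -- gives Q₀ ≤ Q₁, so Q₀ is stable under the whole Lie algebra, without the PBW theorem.
  let Q₁ : Submodule ℂ M :=
    { carrier := {y | y ∈ Q₀ ∧ ∀ x : 𝔰𝔩 n, UniversalEnvelopingAlgebra.ι ℂ x • y ∈ Q₀}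
      add_mem' := by
        rintro y z ⟨hy, hy'⟩ ⟨hz, hz'⟩
        refine ⟨Q₀.add_mem hy hz, fun x => ?_⟩
        rw [smul_add]
        exact Q₀.add_mem (hy' x) (hz' x)
      zero_mem' := ⟨Q₀.zero_mem, fun x => by rw [smul_zero]; exact Q₀.zero_mem⟩
      smul_mem' := by
        rintro a y ⟨hy, hy'⟩
        refine ⟨Q₀.smul_mem a hy, fun x => ?_⟩
        rw [smul_algebra_smul_comm]
        exact Q₀.smul_mem a (hy' x) }
  have hQ₁ : Q₁ ∈ 𝒬 := by
    refine ⟨⟨hv₀, fun x => ?_⟩, ?_⟩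
    · rw [eq_sum_X x]
      simp only [map_sum, map_smul, Finset.sum_smul, smul_assoc]
      refine Q₀.sum_mem fun i _ => Q₀.sum_mem fun j _ => Q₀.smul_mem _ ?_
      rcases lt_trichotomy i j with h | h | h
      · rw [hv.raise i j h]
        exact Q₀.zero_mem
      · subst h
        have := hv.cartan (XDiag n i)
        rw [show ((XDiag n i : cartan n) : 𝔰𝔩 n) = X n i i from rfl] at this
        rw [this]
        exact Q₀.smul_mem _ hv₀
      · exact hl₀ j i h v hv₀
    · rintro i j hij y ⟨hy, hy'⟩
      refine ⟨hl₀ i j hij y hy, fun x => ?_⟩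
      rw [ι_mul]
      exact Q₀.add_mem (hl₀ i j hij _ (hy' x)) (hy' _)
  have hstab : ∀ (x : 𝔰𝔩 n), ∀ y ∈ Q₀, UniversalEnvelopingAlgebra.ι ℂ x • y ∈ Q₀ := fun x y hy =>
    ((sInf_le hQ₁ : Q₀ ≤ Q₁) hy).2 x
  refine eq_top_iff.2 fun y _ => ?_
  obtain ⟨u, rfl⟩ := hgen y
  exact (sInf_le (show Q ∈ 𝒬 from ⟨hvQ, hQ⟩) : Q₀ ≤ Q) (smul_mem_of_lie_stable Q₀ hstab u hv₀)

/-- The grading element: `[H, X_ij] = (j - i) X_ij`. -/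
def gradingElement (n : ℕ) : cartan n := ∑ i : Fin n, (-(i : ℕ) : ℂ) • XDiag n i

theorem coe_gradingElement (n : ℕ) :
    ((gradingElement n : cartan n) : 𝔰𝔩 n) = ∑ i : Fin n, (-(i : ℕ) : ℂ) • X n i i := by
  rw [gradingElement, AddSubmonoidClass.coe_finsetSum]
  rfl

theorem lie_gradingElement (i j : Fin n) :
    ⁅((gradingElement n : cartan n) : 𝔰𝔩 n), X n i j⁆ = ((j : ℂ) - (i : ℂ)) • X n i j := by
  rw [coe_gradingElement, sum_lie]
  simp only [smul_lie, lie_X, smul_sub, Finset.sum_sub_distrib, smul_ite, smul_zero,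
    Finset.sum_ite_eq', Finset.mem_univ, if_true]
  module

/-- The vectors without component of weight `c` for the grading element. -/
def offWeight (n : ℕ) (M : Type*) [AddCommGroup M] [Module ℂ M] [Module (Env n) M]
    [IsScalarTower ℂ (Env n) M] (c : ℂ) : Submodule ℂ M where
  carrier := {y | ∃ p : Polynomial ℂ, p.eval c ≠ 0 ∧
    Polynomial.aeval (UniversalEnvelopingAlgebra.ι ℂ ((gradingElement n : cartan n) : 𝔰𝔩 n)) p • y
      = 0}
  add_mem' := by
    rintro y z ⟨p, hp, hpy⟩ ⟨q, hq, hqz⟩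
    refine ⟨p * q, by simp [hp, hq], ?_⟩
    rw [smul_add, map_mul, mul_smul _ _ z, hqz, smul_zero, add_zero, ← map_mul, mul_comm p q,
      map_mul, mul_smul, hpy, smul_zero]
  zero_mem' := ⟨1, by simp, by simp⟩
  smul_mem' := by
    rintro a y ⟨p, hp, hpy⟩
    exact ⟨p, hp, by rw [smul_algebra_smul_comm, hpy, smul_zero]⟩

theorem aeval_smul_of_smul_eq {M : Type*} [AddCommGroup M] [Module ℂ M] [Module (Env n) M]
    [IsScalarTower ℂ (Env n) M] {u : Env n} {v : M} {c : ℂ} (h : u • v = c • v)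
    (p : Polynomial ℂ) : Polynomial.aeval u p • v = p.eval c • v := by
  induction p using Polynomial.induction_on' with
  | add p q hp hq => rw [map_add, add_smul, hp, hq, Polynomial.eval_add, add_smul]
  | monomial k a =>
    have hk : u ^ k • v = c ^ k • v := by
      induction k with
      | zero => simp
      | succ k ih => rw [pow_succ', mul_smul, ih, smul_algebra_smul_comm, h, smul_smul, pow_succ]
    rw [Polynomial.aeval_monomial, mul_smul, hk, algebraMap_smul, smul_smul,
      Polynomial.eval_monomial]

/-- Each lowering operator decreases the eigenvalue of the grading element by a positive integer, so
everything obtained from v by lowering, other than v itself, is a sum of eigenvectors with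
eigenvalues different from c. -/
theorem span_sup_offWeight {M : Type*} [AddCommGroup M] [Module ℂ M] [Module (Env n) M]
    [IsScalarTower ℂ (Env n) M] {ν : Weight n} {v : M} (hv : IsSingular ν v)
    (hgen : ∀ y : M, ∃ u : Env n, y = u • v) :
    Submodule.span ℂ {v} ⊔ offWeight n M (ν (gradingElement n)) = ⊤ := by
  set H := UniversalEnvelopingAlgebra.ι ℂ ((gradingElement n : cartan n) : 𝔰𝔩 n) with hH
  set c := ν (gradingElement n) with hc
  let E : ℕ → Submodule ℂ M := fun d => (Algebra.lsmul ℂ ℂ M H).eigenspace (c - (d + 1))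
  have hE : ∀ d y, y ∈ E d ↔ H • y = (c - (d + 1)) • y := fun d y =>
    Module.End.mem_eigenspace_iff
  have hHv : H • v = c • v := hv.cartan (gradingElement n)
  have hlow : ∀ (i j : Fin n) (a : ℂ) (y : M), H • y = a • y →
      H • UniversalEnvelopingAlgebra.ι ℂ (X n j i) • y
        = (a - ((j : ℂ) - (i : ℂ))) • UniversalEnvelopingAlgebra.ι ℂ (X n j i) • y := by
    intro i j a y hy
    rw [hH, ι_mul, ← hH, hy, lie_gradingElement, map_smul, smul_assoc, smul_algebra_smul_comm,
      ← add_smul]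
    congr 1
    ring
  have htop : Submodule.span ℂ {v} ⊔ ⨆ d, E d = ⊤ := by
    refine eq_top_of_lowering_stable hv hgen _
      (Submodule.mem_sup_left (Submodule.mem_span_singleton_self v)) fun i j hij => ?_
    have hij' : (i : ℕ) < j := hij
    have : Submodule.span ℂ {v} ⊔ ⨆ d, E d ≤ (Submodule.span ℂ {v} ⊔ ⨆ d, E d).comap
        (Algebra.lsmul ℂ ℂ M (UniversalEnvelopingAlgebra.ι ℂ (X n j i))) := by
      refine sup_le ((Submodule.span_singleton_le_iff_mem _ _).2 ?_) (iSup_le fun d y hy => ?_)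
      -- `E d` has eigenvalue c - (d + 1), so lowering v by j - i lands at index j - i - 1; from `E
      -- d` the index becomes d + (j - i).
      · refine Submodule.mem_sup_right (Submodule.mem_iSup_of_mem (j - i - 1 : ℕ) ?_)
        refine (hE _ _).2 ((hlow i j c v hHv).trans ?_)
        congr 2
        rw [Nat.cast_sub (by omega), Nat.cast_sub (by omega)]
        push_cast
        ring
      · refine Submodule.mem_sup_right (Submodule.mem_iSup_of_mem (d + (j - i) : ℕ) ?_)
        refine (hE _ _).2 ((hlow i j _ y ((hE d y).1 hy)).trans ?_)
        congr 1
        rw [Nat.cast_add, Nat.cast_sub (by omega)]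
        ring
    exact fun y hy => this hy
  rw [eq_top_iff, ← htop]
  refine sup_le_sup_left (iSup_le fun d y hy => ?_) _
  refine ⟨Polynomial.X - Polynomial.C (c - (d + 1)), ?_, ?_⟩
  · simp only [Polynomial.eval_sub, Polynomial.eval_X, Polynomial.eval_C, sub_sub_cancel]
    exact_mod_cast Nat.succ_ne_zero d
  · rw [map_sub, Polynomial.aeval_X, Polynomial.aeval_C, sub_smul, algebraMap_smul,
      (hE d y).1 hy, sub_self]

/-- The generator of the Verma module. -/
def vermaVec (ν : Weight n) : Verma ν := Submodule.Quotient.mk 1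

theorem exists_smul_vermaVec (ν : Weight n) (y : Verma ν) : ∃ u : Env n, y = u • vermaVec ν := by
  obtain ⟨u, rfl⟩ := Submodule.Quotient.mk_surjective _ y
  exact ⟨u, by rw [vermaVec, ← Submodule.Quotient.mk_smul, smul_eq_mul, mul_one]⟩

theorem isSingular_vermaVec (ν : Weight n) : IsSingular ν (vermaVec ν) where
  raise i j hij := by
    rw [vermaVec, ← Submodule.Quotient.mk_smul, smul_eq_mul, mul_one, Submodule.Quotient.mk_eq_zero]
    exact Submodule.subset_span (Or.inl ⟨i, j, hij, rfl⟩)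
  cartan h := by
    rw [← algebraMap_smul (Env n) (ν h) (vermaVec ν), vermaVec, ← Submodule.Quotient.mk_smul,
      ← Submodule.Quotient.mk_smul, smul_eq_mul, smul_eq_mul, mul_one, mul_one,
      Submodule.Quotient.eq]
    exact Submodule.subset_span (Or.inr ⟨h, rfl⟩)

/-- If y had a nonzero component along the generator, a polynomial in the grading element killing
the rest of y would leave a nonzero multiple of the generator in N, so N would be everything. -/
theorem restrictScalars_le_offWeight (ν : Weight n) {N : Submodule (Env n) (Verma ν)}
    (hN : N ≠ ⊤) {y : Verma ν} (hy : y ∈ N) :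
    y ∈ offWeight n (Verma ν) (ν (gradingElement n)) := by
  have hy' : y ∈ Submodule.span ℂ {vermaVec ν} ⊔ offWeight n (Verma ν) (ν (gradingElement n)) := by
    rw [span_sup_offWeight (isSingular_vermaVec ν) (exists_smul_vermaVec ν)]
    trivial
  obtain ⟨x, hx, z, hz, rfl⟩ := Submodule.mem_sup.1 hy'
  obtain ⟨a, rfl⟩ := Submodule.mem_span_singleton.1 hx
  suffices ha : a = 0 by simpa [ha] using hz
  by_contra ha
  obtain ⟨p, hp, hpz⟩ := hz
  have h1 := N.smul_mem (Polynomial.aeval (UniversalEnvelopingAlgebra.ι ℂ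
    ((gradingElement n : cartan n) : 𝔰𝔩 n)) p) hy
  rw [smul_add, hpz, add_zero, smul_algebra_smul_comm,
    aeval_smul_of_smul_eq ((isSingular_vermaVec ν).cartan (gradingElement n)), smul_smul,
    ← algebraMap_smul (Env n)] at h1
  have h2 := N.smul_mem (algebraMap ℂ (Env n) (a * p.eval (ν (gradingElement n)))⁻¹) h1
  rw [smul_smul, ← map_mul, inv_mul_cancel₀ (mul_ne_zero ha hp), map_one, one_smul] at h2
  refine hN (eq_top_iff.2 fun x _ => ?_)
  obtain ⟨u, rfl⟩ := exists_smul_vermaVec ν x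
  exact N.smul_mem u h2

variable {ι : Type} [Fintype ι] [DecidableEq ι]

/-- The grading element is diagonal, hence self-adjoint for the pairing. From p(H) F = 0 follows
p(c) · pair F w = 0, with p(c) ≠ 0. -/
theorem pair_eq_zero_of_mem_offWeight {ν : Weight n} {w : Fn n ι} (hw : IsSingular ν w) {F : Fn n ι}
    (hF : F ∈ offWeight n (Fn n ι) (ν (gradingElement n))) : pair F w = 0 := by
  obtain ⟨p, hp, hpF⟩ := hF
  set H := UniversalEnvelopingAlgebra.ι ℂ ((gradingElement n : cartan n) : 𝔰𝔩 n) with hH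
  have hself : ∀ G : Fn n ι, pair (H • G) w = ν (gradingElement n) * pair G w := by
    intro G
    have hT : (((gradingElement n : cartan n) : 𝔰𝔩 n) : Matrix (Fin n) (Fin n) ℂ).transpose
        = ((gradingElement n : cartan n) : 𝔰𝔩 n) := by
      ext i j
      by_cases hij : i = j
      · rw [hij]; rfl
      · exact ((gradingElement n).2 j i (Ne.symm hij)).trans ((gradingElement n).2 i j hij).symm
    rw [hH, ι_smul, pair_act, hT, ← ι_smul, hw.cartan, pair_smul_right]
  have hpoly : ∀ q : Polynomial ℂ,
      pair (Polynomial.aeval H q • F) w = q.eval (ν (gradingElement n)) * pair F w := by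
    intro q
    induction q using Polynomial.induction_on' with
    | add p q hp hq => rw [map_add, add_smul, pair_add_left, hp, hq, Polynomial.eval_add, add_mul]
    | monomial k a =>
      have hk : pair (H ^ k • F) w = ν (gradingElement n) ^ k * pair F w := by
        induction k with
        | zero => simp
        | succ k ih => rw [pow_succ', mul_smul, hself, ih, pow_succ', mul_assoc]
      rw [Polynomial.aeval_monomial, mul_smul, algebraMap_smul, pair_smul_left, hk,
        Polynomial.eval_monomial, mul_assoc]
  have := hpoly p
  rw [hpF, pair_zero_left] at this
  exact (mul_eq_zero.1 this.symm).resolve_left hp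

/-- The map from the Verma module to a tensor power determined by a singular vector. -/
def vermaMap {ν : Weight n} {w : Fn n ι} (hw : IsSingular ν w) : Verma ν →ₗ[Env n] Fn n ι :=
  Submodule.liftQ (vermaIdeal ν) (LinearMap.toSpanSingleton (Env n) (Fn n ι) w) <| by
    refine Submodule.span_le.2 ?_
    rintro u (⟨i, j, hij, rfl⟩ | ⟨h, rfl⟩)
    · exact hw.raise i j hij
    · change (_ - _ : Env n) • w = 0
      rw [sub_smul, hw.cartan, algebraMap_smul, sub_self]

theorem vermaMap_vermaVec {ν : Weight n} {w : Fn n ι} (hw : IsSingular ν w) :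
    vermaMap hw (vermaVec ν) = w :=
  one_smul (Env n) w

theorem map_offWeight {ν : Weight n} {w : Fn n ι} (hw : IsSingular ν w) {y : Verma ν} {c : ℂ}
    (hy : y ∈ offWeight n (Verma ν) c) : vermaMap hw y ∈ offWeight n (Fn n ι) c := by
  obtain ⟨p, hp, hpy⟩ := hy
  exact ⟨p, hp, by rw [← map_smul, hpy, map_zero]⟩

theorem conj_act (A : Matrix (Fin n) (Fin n) ℂ) (F : Fn n ι) :
    conj (act A F) = act (A.map (starRingEnd ℂ)) (conj F) := by
  rw [act_conj]
  congr 3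
  ext i j
  simp

/-- The conjugate transpose on `sl_n`. -/
def slStar (x : 𝔰𝔩 n) : 𝔰𝔩 n := ⟨(x : Matrix (Fin n) (Fin n) ℂ).conjTranspose, by
  have : (x : Matrix (Fin n) (Fin n) ℂ).trace = 0 := x.2
  change (x : Matrix (Fin n) (Fin n) ℂ).conjTranspose.trace = 0
  rw [Matrix.trace_conjTranspose, this, star_zero]⟩

theorem pair_conj_act (x : 𝔰𝔩 n) (F G : Fn n ι) :
    pair F (conj (act (x : Matrix (Fin n) (Fin n) ℂ) G))
      = pair (act ((slStar x : 𝔰𝔩 n) : Matrix (Fin n) (Fin n) ℂ) F) (conj G) := by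
  rw [conj_act, pair_act]
  rfl

/-- The vectors orthogonal to the image of N form a submodule, because the Hermitian form is
contravariant for the conjugate transpose. It contains w, since elements of N have no component of
the top weight, and hence everything generated by w, including the image of N. That image is
orthogonal to itself and so vanishes. -/
theorem vermaMap_eq_zero {ν : Weight n} {w : Fn n ι} (hw : IsSingular ν w) (hr : conj w = w)
    {N : Submodule (Env n) (Verma ν)} (hN : N ≠ ⊤) {y : Verma ν} (hy : y ∈ N) :
    vermaMap hw y = 0 := by
  let Q : Submodule ℂ (Fn n ι) :=
    { carrier := {G | ∀ z ∈ N, pair (vermaMap hw z) (conj G) = 0}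
      add_mem' := by
        intro G G' hG hG' z hz
        have : pair (vermaMap hw z) (conj (G + G'))
            = pair (vermaMap hw z) (conj G) + pair (vermaMap hw z) (conj G') := by
          simp [pair, conj, Fn.add_apply, mul_add, Finset.sum_add_distrib]
        rw [this, hG z hz, hG' z hz, add_zero]
      zero_mem' := fun z _ => by simp [pair, conj, Fn.zero_apply]
      smul_mem' := by
        intro a G hG z hz
        have : conj (a • G) = starRingEnd ℂ a • conj G :=
          funext fun t => map_mul (starRingEnd ℂ) a (G t)
        rw [this, pair_smul_right, hG z hz, mul_zero] }
  have hQ : ∀ (x : 𝔰𝔩 n), ∀ G ∈ Q, UniversalEnvelopingAlgebra.ι ℂ x • G ∈ Q := by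
    intro x G hG z hz
    rw [ι_smul, pair_conj_act, ← ι_smul, ← map_smul]
    exact hG _ (N.smul_mem _ hz)
  have hwQ : w ∈ Q := fun z hz => by
    rw [hr]
    exact pair_eq_zero_of_mem_offWeight hw (map_offWeight hw (restrictScalars_le_offWeight ν hN hz))
  obtain ⟨u, rfl⟩ := exists_smul_vermaVec ν y
  refine pair_conj_self_eq_zero ?_
  have h : vermaMap hw (u • vermaVec ν) = u • w := by rw [map_smul, vermaMap_vermaVec]
  have h0 := smul_mem_of_lie_stable Q hQ u hwQ _ hy
  rw [h] at h0 ⊢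
  exact h0

/-- Every proper submodule maps to zero, and the kernel is itself proper because the generator goes
to w ≠ 0. In particular the sum of all proper submodules is proper. -/
theorem vermaRadical_eq_ker {ν : Weight n} {w : Fn n ι} (hw : IsSingular ν w) (hr : conj w = w)
    (hw0 : w ≠ 0) : vermaRadical ν = LinearMap.ker (vermaMap hw) := by
  refine le_antisymm (sSup_le fun N hN y hy => vermaMap_eq_zero hw hr hN hy)
    (le_sSup fun h => hw0 ?_)
  have : vermaVec ν ∈ LinearMap.ker (vermaMap hw) := by rw [h]; trivial
  rw [← vermaMap_vermaVec hw]
  exact this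

/-- The embedding of the irreducible module into a tensor power. -/
def embed {ν : Weight n} {w : Fn n ι} (hw : IsSingular ν w) (hr : conj w = w) (hw0 : w ≠ 0) :
    V ν →ₗ[Env n] Fn n ι :=
  Submodule.liftQ (vermaRadical ν) (vermaMap hw) (vermaRadical_eq_ker hw hr hw0).le

theorem embed_injective {ν : Weight n} {w : Fn n ι} (hw : IsSingular ν w) (hr : conj w = w)
    (hw0 : w ≠ 0) : Function.Injective (embed hw hr hw0) := by
  refine LinearMap.ker_eq_bot.1 ?_
  exact Submodule.ker_liftQ_eq_bot _ _ _ (vermaRadical_eq_ker hw hr hw0).ge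

/-- The highest weight vector of the irreducible module. -/
def highestVec (ν : Weight n) : V ν := Submodule.Quotient.mk (vermaVec ν)

theorem embed_highestVec {ν : Weight n} {w : Fn n ι} (hw : IsSingular ν w) (hr : conj w = w)
    (hw0 : w ≠ 0) : embed hw hr hw0 (highestVec ν) = w :=
  vermaMap_vermaVec hw

theorem exists_smul_highestVec (ν : Weight n) (y : V ν) : ∃ u : Env n, y = u • highestVec ν := by
  obtain ⟨y, rfl⟩ := Submodule.Quotient.mk_surjective (vermaRadical ν) y
  obtain ⟨u, rfl⟩ := exists_smul_vermaVec ν y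
  exact ⟨u, rfl⟩

theorem isSingular_highestVec (ν : Weight n) : IsSingular ν (highestVec ν) where
  raise i j hij := by
    have := congrArg (Submodule.Quotient.mk (p := vermaRadical ν))
      ((isSingular_vermaVec ν).raise i j hij)
    exact this
  cartan h := by
    have := congrArg (Submodule.Quotient.mk (p := vermaRadical ν))
      ((isSingular_vermaVec ν).cartan h)
    exact this

theorem lie_eq_smul {ν : Weight n} (x : 𝔰𝔩 n) (y : V ν) :
    ⁅x, y⁆ = UniversalEnvelopingAlgebra.ι ℂ x • y := rfl

theorem isIrreducible_V {ν : Weight n} (hν : vermaRadical ν ≠ ⊤) :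
    LieModule.IsIrreducible ℂ (𝔰𝔩 n) (V ν) := by
  have : Nontrivial (V ν) := Submodule.Quotient.nontrivial_iff.2 hν
  refine LieModule.IsIrreducible.mk fun N hN => ?_
  let N' : Submodule (Env n) (V ν) :=
    { N.toSubmodule with
      smul_mem' := fun u y hy =>
        smul_mem_of_lie_stable N.toSubmodule (fun x y hy => N.lie_mem hy) u hy }
  by_contra hN'
  refine hN ((LieSubmodule.eq_bot_iff N).2 fun y hy => ?_)
  have hcomap : N'.comap (vermaRadical ν).mkQ ≠ ⊤ := by
    intro h
    refine hN' (eq_top_iff.2 fun z _ => ?_)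
    obtain ⟨z, rfl⟩ := Submodule.Quotient.mk_surjective (vermaRadical ν) z
    have : z ∈ N'.comap (vermaRadical ν).mkQ := by rw [h]; trivial
    exact this
  obtain ⟨y, rfl⟩ := Submodule.Quotient.mk_surjective (vermaRadical ν) y
  have : y ∈ vermaRadical ν := (le_sSup hcomap : N'.comap (vermaRadical ν).mkQ ≤ vermaRadical ν) hy
  exact (Submodule.Quotient.mk_eq_zero _).2 this

end HighestWeight

/-! ### Complete reducibility and coinvariants inside a tensor power -/

section Embedded

set_option linter.unusedSectionVars false

variable {n : ℕ} {ι : Type} [Fintype ι] [DecidableEq ι] {T : Type} [AddCommGroup T] [Module ℂ T]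
  [LieRingModule (𝔰𝔩 n) T] [LieModule ℂ (𝔰𝔩 n) T] {J : T →ₗ[ℂ] Fn n ι}

theorem inner_toLp (F G : Fn n ι) :
    inner ℂ (WithLp.toLp 2 F : EuclideanSpace ℂ (ι → Fin n)) (WithLp.toLp 2 G)
      = pair G (conj F) := by
  rw [PiLp.inner_apply]
  rfl

/-- A submodule of a tensor power is completely reducible. -/
theorem exists_isCompl_of_embedding (hJ : Function.Injective J)
    (hact : ∀ (x : 𝔰𝔩 n) (t : T), J ⁅x, t⁆ = act (x : Matrix (Fin n) (Fin n) ℂ) (J t))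
    (N : LieSubmodule ℂ (𝔰𝔩 n) T) : ∃ N' : LieSubmodule ℂ (𝔰𝔩 n) T, IsCompl N N' := by
  let e : T →ₗ[ℂ] EuclideanSpace ℂ (ι → Fin n) :=
    (WithLp.linearEquiv 2 ℂ ((ι → Fin n) → ℂ)).symm.toLinearMap.comp J
  have he : Function.Injective e := (WithLp.linearEquiv 2 ℂ _).symm.injective.comp hJ
  have hinner : ∀ s t : T, inner ℂ (e s) (e t) = pair (J t) (conj (J s)) := fun s t =>
    inner_toLp (J s) (J t)
  set K := N.toSubmodule.map e with hK
  let N' : LieSubmodule ℂ (𝔰𝔩 n) T :=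
    { Kᗮ.comap e with
      lie_mem := by
        intro x t ht y hy
        obtain ⟨m, hm, rfl⟩ := hy
        have h1 : slStar (slStar x) = x :=
          Subtype.ext (Matrix.conjTranspose_conjTranspose (x : Matrix (Fin n) (Fin n) ℂ))
        have h2 := pair_conj_act (slStar x) (J t) (J m)
        rw [h1] at h2
        rw [hinner, hact, ← h2, ← hact, ← hinner]
        exact ht _ ⟨_, N.lie_mem hm, rfl⟩ }
  have hN' : ∀ t, t ∈ N' ↔ e t ∈ Kᗮ := fun t => Iff.rfl
  refine ⟨N', disjoint_iff.2 ?_, codisjoint_iff.2 ?_⟩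
  · refine (LieSubmodule.eq_bot_iff _).2 fun t ht => ?_
    obtain ⟨h1, h2⟩ := (LieSubmodule.mem_inf ..).1 ht
    have h0 : e t = 0 := inner_self_eq_zero.1 (((hN' t).1 h2) (e t) ⟨t, h1, rfl⟩)
    exact he (h0.trans (map_zero e).symm)
  · refine eq_top_iff.2 fun t _ => ?_
    obtain ⟨y, ⟨m, hm, rfl⟩, z, hz, hyz⟩ := K.exists_add_mem_mem_orthogonal (e t)
    refine (LieSubmodule.mem_sup _ _ _).2 ⟨m, hm, t - m, (hN' _).2 ?_, add_sub_cancel m t⟩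
    rw [map_sub, hyz, add_sub_cancel_left]
    exact hz

theorem XMat_lower {i j : Fin n} (hij : i < j) (a b : Fin n) (hab : a ≤ b) :
    XMat n j i a b = 0 := by
  rw [XMat_apply, if_neg, if_neg, sub_zero]
  · exact fun h => hij.ne' h.1
  · rintro ⟨rfl, rfl⟩
    exact absurd hij (not_lt.2 hab)

theorem XMat_upper {i j : Fin n} (hij : i < j) (a b : Fin n) (hab : b ≤ a) :
    XMat n i j a b = 0 := by
  rw [XMat_apply, if_neg, if_neg, sub_zero]
  · exact fun h => hij.ne h.1
  · rintro ⟨rfl, rfl⟩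
    exact absurd hij (not_lt.2 hab)

theorem XMat_transpose (i j : Fin n) : (XMat n i j).transpose = XMat n j i := by
  ext a b
  rw [Matrix.transpose_apply, XMat_apply, XMat_apply]
  congr 2
  · exact propext and_comm
  · exact propext ⟨fun h => ⟨h.1.symm, h.2.symm⟩, fun h => ⟨h.1.symm, h.2.symm⟩⟩

/-- A nonzero submodule of a tensor power has nonzero coinvariants. -/
theorem eq_bot_of_le_lowered (hJ : Function.Injective J)
    (hact : ∀ (x : 𝔰𝔩 n) (t : T), J ⁅x, t⁆ = act (x : Matrix (Fin n) (Fin n) ℂ) (J t))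
    (N : LieSubmodule ℂ (𝔰𝔩 n) T) (hN : N.toSubmodule ≤ lowered (lowering n) N) : N = ⊥ := by
  -- If all of N vanishes at multi-indices of sum below m, then lowered vectors vanish below m + 1,
  -- and by hypothesis these exhaust N.
  have key : ∀ m : ℕ, ∀ y ∈ N, ∀ t : ι → Fin n, ∑ p, (t p : ℕ) < m → J y t = 0 := by
    intro m
    induction m with
    | zero => intro y _ t ht; exact absurd ht (Nat.not_lt_zero _)
    | succ m ih =>
      intro y hy
      let Q : Submodule ℂ T :=
        { carrier := {y | ∀ t : ι → Fin n, ∑ p, (t p : ℕ) < m + 1 → J y t = 0}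
          add_mem' := by
            intro y z hy hz t ht
            rw [map_add, Fn.add_apply, hy t ht, hz t ht, add_zero]
          zero_mem' := fun t _ => by rw [map_zero, Fn.zero_apply]
          smul_mem' := by
            intro a y hy t ht
            rw [map_smul, Fn.smul_apply, hy t ht, mul_zero] }
      have hQ : lowered (lowering n) N ≤ Q := by
        refine Submodule.span_le.2 ?_
        rintro _ ⟨f, ⟨i, j, hij, rfl⟩, z, hz, rfl⟩ t ht
        rw [hact]
        exact act_lower_eq_zero (XMat_lower hij) (ih z hz) t ht
      exact hQ (hN hy)
  refine (LieSubmodule.eq_bot_iff N).2 fun y hy => hJ ?_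
  rw [map_zero]
  funext t
  exact key (∑ p, (t p : ℕ) + 1) y hy t (Nat.lt_succ_self _)

/-- Negative root vectors are transposes of positive ones, which kill W. Pairing with a singular
vector therefore tests whether a class in the coinvariants is nonzero. -/
theorem pair_eq_zero_of_mem_lowered
    (hact : ∀ (x : 𝔰𝔩 n) (t : T), J ⁅x, t⁆ = act (x : Matrix (Fin n) (Fin n) ℂ) (J t))
    {W : Fn n ι} {μ : Weight n} (hW : IsSingular μ W) {y : T}
    (hy : y ∈ lowered (lowering n) (⊤ : LieSubmodule ℂ (𝔰𝔩 n) T)) : pair (J y) W = 0 := by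
  induction hy using Submodule.span_induction with
  | mem y h =>
    obtain ⟨f, ⟨i, j, hij, rfl⟩, t, -, rfl⟩ := h
    have h1 : act (XMat n i j) W = 0 := by
      rw [← hW.raise i j hij, ι_smul]
      rfl
    have h2 : ((X n j i : 𝔰𝔩 n) : Matrix (Fin n) (Fin n) ℂ).transpose = XMat n i j :=
      XMat_transpose j i
    rw [hact, pair_act, h2, h1]
    simp [pair, Fn.zero_apply]
  | zero => rw [map_zero, pair_zero_left]
  | add y z _ _ hy hz => rw [map_add, pair_add_left, hy, hz, add_zero]
  | smul a y _ hy => rw [map_smul, pair_smul_left, hy, mul_zero]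

end Embedded

/-! ### Tensor products of two embedded modules -/

section Tensor

variable {n : ℕ} {ι κ : Type} [Fintype ι] [DecidableEq ι] [Fintype κ] [DecidableEq κ]
  {l ν : Weight n}

/-- The embedding of a tensor product of modules into a tensor power. -/
def tensorEmbed (j₁ : V l →ₗ[Env n] Fn n ι) (j₂ : V ν →ₗ[Env n] Fn n κ) :
    V l ⊗[ℂ] V ν →ₗ[ℂ] Fn n (ι ⊕ κ) :=
  TensorProduct.lift (LinearMap.mk₂ ℂ
    (fun x y => (fun t => j₁ x (t ∘ Sum.inl) * j₂ y (t ∘ Sum.inr) : Fn n (ι ⊕ κ)))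
    (fun x x' y => funext fun t => by
      rw [map_add, Fn.add_apply]
      exact add_mul _ _ _)
    (fun a x y => funext fun t => by
      rw [LinearMap.map_smul_of_tower, Fn.smul_apply]
      exact mul_assoc _ _ _)
    (fun x y y' => funext fun t => by
      rw [map_add, Fn.add_apply]
      exact mul_add _ _ _)
    (fun a x y => funext fun t => by
      rw [LinearMap.map_smul_of_tower, Fn.smul_apply]
      exact mul_left_comm _ _ _))

variable (j₁ : V l →ₗ[Env n] Fn n ι) (j₂ : V ν →ₗ[Env n] Fn n κ)

theorem tensorEmbed_tmul (x : V l) (y : V ν) (t : ι ⊕ κ → Fin n) :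
    tensorEmbed j₁ j₂ (x ⊗ₜ y) t = j₁ x (t ∘ Sum.inl) * j₂ y (t ∘ Sum.inr) := rfl

theorem map_lie_eq_act (x : 𝔰𝔩 n) (y : V l) :
    j₁ ⁅x, y⁆ = act (x : Matrix (Fin n) (Fin n) ℂ) (j₁ y) := by
  rw [lie_eq_smul, map_smul, ι_smul]

theorem tensorEmbed_lie (x : 𝔰𝔩 n) (t : V l ⊗[ℂ] V ν) :
    tensorEmbed j₁ j₂ ⁅x, t⁆ = act (x : Matrix (Fin n) (Fin n) ℂ) (tensorEmbed j₁ j₂ t) := by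
  induction t using TensorProduct.induction_on with
  | zero => rw [lie_zero, map_zero, map_zero]
  | add s t hs ht => rw [lie_add, map_add, map_add, map_add, hs, ht]
  | tmul y z =>
    rw [TensorProduct.LieModule.lie_tmul_right, map_add]
    funext t
    rw [Fn.add_apply, tensorEmbed_tmul, tensorEmbed_tmul, map_lie_eq_act, map_lie_eq_act,
      act_apply, act_apply, act_apply, Fintype.sum_sum_type, Finset.sum_mul, Finset.mul_sum]
    congr 1
    · refine Finset.sum_congr rfl fun p _ => ?_
      rw [Finset.sum_mul]
      refine Finset.sum_congr rfl fun j _ => ?_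
      rw [tensorEmbed_tmul, Sum.update_inl_comp_inl, Sum.update_inl_comp_inr, mul_assoc]
      rfl
    · refine Finset.sum_congr rfl fun p _ => ?_
      rw [Finset.mul_sum]
      refine Finset.sum_congr rfl fun j _ => ?_
      rw [tensorEmbed_tmul, Sum.update_inr_comp_inl, Sum.update_inr_comp_inr, mul_left_comm]
      rfl

variable {j₁ j₂}

theorem tensorEmbed_injective (h₁ : Function.Injective j₁) (h₂ : Function.Injective j₂) :
    Function.Injective (tensorEmbed j₁ j₂) := by
  classical
  refine (injective_iff_map_eq_zero _).2 fun t ht => ?_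
  let b := Module.Basis.ofVectorSpace ℂ (V l)
  obtain ⟨y, rfl⟩ := (TensorProduct.equivFinsuppOfBasisLeft (N := V ν) b).symm.surjective t
  suffices hy : y = 0 by rw [hy, map_zero]
  have hli : LinearIndependent ℂ fun i => j₁ (b i) :=
    b.linearIndependent.map' (j₁.restrictScalars ℂ) (LinearMap.ker_eq_bot.2 h₁)
  refine Finsupp.ext fun i => h₂ ?_
  rw [Finsupp.zero_apply, map_zero]
  funext v
  by_cases hi : i ∈ y.support
  · refine linearIndependent_iff'.1 hli y.support (fun i => j₂ (y i) v) ?_ i hi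
    funext u
    rw [Fn.sum_apply, Fn.zero_apply]
    have := congrFun ht (Sum.elim u v)
    rw [TensorProduct.equivFinsuppOfBasisLeft_symm_apply, Finsupp.sum, map_sum,
      Fn.sum_apply] at this
    refine (Finset.sum_congr rfl fun i _ => ?_).trans this
    rw [tensorEmbed_tmul, Fn.smul_apply, mul_comm, Sum.elim_comp_inl, Sum.elim_comp_inr]
  · rw [Finsupp.notMem_support_iff.1 hi, map_zero]

/-- A tensor product with a highest weight module is generated, modulo the image of the negative
root vectors, by the tensors with the highest weight vector. -/
theorem span_tmul_sup_lowered {K : Type*} (b : Module.Basis K ℂ (V l)) :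
    Submodule.span ℂ (Set.range fun i => b i ⊗ₜ[ℂ] highestVec ν)
      ⊔ lowered (lowering n) (⊤ : LieSubmodule ℂ (𝔰𝔩 n) (V l ⊗[ℂ] V ν)) = ⊤ := by
  set R := Submodule.span ℂ (Set.range fun i => b i ⊗ₜ[ℂ] highestVec ν)
      ⊔ lowered (lowering n) (⊤ : LieSubmodule ℂ (𝔰𝔩 n) (V l ⊗[ℂ] V ν)) with hR
  let Q : Submodule ℂ (V ν) :=
    { carrier := {y | ∀ x : V l, x ⊗ₜ[ℂ] y ∈ R}
      add_mem' := by
        intro y z hy hz x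
        rw [TensorProduct.tmul_add]
        exact R.add_mem (hy x) (hz x)
      zero_mem' := fun x => by rw [TensorProduct.tmul_zero]; exact R.zero_mem
      smul_mem' := by
        intro a y hy x
        rw [TensorProduct.tmul_smul]
        exact R.smul_mem a (hy x) }
  have hQ : Q = ⊤ := by
    refine eq_top_of_lowering_stable (isSingular_highestVec ν) (exists_smul_highestVec ν) Q ?_ ?_
    · intro x
      have hx : x ∈ Submodule.span ℂ (Set.range b) := by rw [b.span_eq]; trivial
      induction hx using Submodule.span_induction with
      | mem x h =>
        obtain ⟨i, rfl⟩ := h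
        exact Submodule.mem_sup_left (Submodule.subset_span ⟨i, rfl⟩)
      | zero => rw [TensorProduct.zero_tmul]; exact R.zero_mem
      | add x y _ _ hx hy => rw [TensorProduct.add_tmul]; exact R.add_mem hx hy
      | smul a x _ hx => rw [← TensorProduct.smul_tmul']; exact R.smul_mem a hx
    · intro i j hij y hy x
      -- By the Leibniz rule a lowering vector moves from the right factor to the left modulo 𝔫⁻T,
      -- and `Q` quantifies over all left factors.
      have h1 : x ⊗ₜ[ℂ] (UniversalEnvelopingAlgebra.ι ℂ (X n j i) • y)
          = ⁅X n j i, x ⊗ₜ[ℂ] y⁆ - ⁅X n j i, x⁆ ⊗ₜ[ℂ] y := by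
        rw [TensorProduct.LieModule.lie_tmul_right, add_sub_cancel_left, lie_eq_smul _ y]
      rw [h1]
      exact R.sub_mem (Submodule.mem_sup_right
        (lie_mem_lowered (F := lowering n) ⟨i, j, hij, rfl⟩ trivial)) (hy _)
  refine eq_top_iff.2 fun t _ => ?_
  induction t using TensorProduct.induction_on with
  | zero => exact R.zero_mem
  | add s t hs ht => exact R.add_mem (hs trivial) (ht trivial)
  | tmul x y =>
    have : y ∈ Q := by rw [hQ]; trivial
    exact this x

end Tensor

/-! ### Products of determinants as singular vectors -/

section Labels

variable {n : ℕ} {ι : Type} [Fintype ι] [DecidableEq ι]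

/-- The weight of a tensor with the given labels. -/
def labelWeight (c : ι → Fin n) : Weight n where
  toFun h := ∑ q, ((h : 𝔰𝔩 n) : Matrix (Fin n) (Fin n) ℂ) (c q) (c q)
  map_add' a b := by simp [Finset.sum_add_distrib]
  map_smul' r a := by simp [Finset.mul_sum]

theorem isSingular_detVec {B : Type} [DecidableEq B] {π : ι → B} {c : ι → Fin n}
    (h : IsLabelling π c) : IsSingular (labelWeight c) (detVec π c) where
  raise i j hij := by
    rw [ι_smul]
    refine (act_detVec h fun a b hab => XMat_upper hij a b hab.le).trans ?_
    rw [Finset.sum_eq_zero fun q _ => XMat_upper hij _ _ le_rfl, zero_smul]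
  cartan x := by
    rw [ι_smul]
    exact act_detVec h fun a b hab => x.2 a b hab.ne'

theorem detVec_ne_zero {B : Type} [DecidableEq B] {π : ι → B} {c : ι → Fin n}
    (h : IsLabelling π c) : detVec π c ≠ 0 := by
  intro h0
  have := detVec_self h
  rw [h0, Fn.zero_apply] at this
  exact zero_ne_one this

end Labels

/-! ### Antisymmetric tensors: multiplicity-free weights and binary expansions -/

section Alternating

set_option linter.unusedSectionVars false

variable {n : ℕ} {ι : Type} [Fintype ι] [DecidableEq ι]

/-- The antisymmetric tensors. -/
def alternating (n : ℕ) (ι : Type) [Fintype ι] [DecidableEq ι] : Submodule ℂ (Fn n ι) where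
  carrier := {F | ∀ (σ : Equiv.Perm ι) (t : ι → Fin n),
    F (t ∘ σ) = ((Equiv.Perm.sign σ : ℤ) : ℂ) * F t}
  add_mem' := by
    intro F G hF hG σ t
    rw [Fn.add_apply, Fn.add_apply, hF, hG, mul_add]
  zero_mem' := fun σ t => by rw [Fn.zero_apply, Fn.zero_apply, mul_zero]
  smul_mem' := by
    intro a F hF σ t
    rw [Fn.smul_apply, Fn.smul_apply, hF, mul_left_comm]

theorem act_mem_alternating (A : Matrix (Fin n) (Fin n) ℂ) {F : Fn n ι}
    (hF : F ∈ alternating n ι) : act A F ∈ alternating n ι := by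
  intro σ t
  rw [act_apply, act_apply, Finset.mul_sum]
  refine Fintype.sum_equiv σ _ _ fun p => ?_
  rw [Finset.mul_sum]
  refine Finset.sum_congr rfl fun j _ => ?_
  have : Function.update (t ∘ σ) p j = Function.update t (σ p) j ∘ σ := by
    funext q
    by_cases hq : q = p
    · subst hq; simp
    · simp [hq]
  rw [this, hF, Function.comp_apply, mul_left_comm]

theorem detVec_mem_alternating (c : ι → Fin n) :
    detVec (fun _ : ι => ()) c ∈ alternating n ι := by
  intro σ t
  rw [detVec, detVec, ← Matrix.det_permute]
  rfl

theorem injective_of_ne_zero {F : Fn n ι} (hF : F ∈ alternating n ι) {t : ι → Fin n}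
    (ht : F t ≠ 0) : Function.Injective t := by
  intro p q hpq
  by_contra hne
  have h1 : t ∘ Equiv.swap p q = t := by
    funext r
    rw [Function.comp_apply, Equiv.swap_apply_def]
    split_ifs with h h'
    · rw [h, hpq]
    · rw [h', hpq]
    · rfl
  have h2 := hF (Equiv.swap p q) t
  rw [h1, Equiv.Perm.sign_swap hne] at h2
  push_cast at h2
  refine ht ?_
  linear_combination h2 / 2

/-- The element `∑ 2^{n-i} X_ii` of the Cartan subalgebra, which separates sets of indices. -/
def binaryElement (n : ℕ) : 𝔰𝔩 n := ∑ i : Fin n, (2 ^ (n - (i : ℕ)) : ℂ) • X n i i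

theorem binaryElement_apply (a b : Fin n) :
    (binaryElement n : Matrix (Fin n) (Fin n) ℂ) a b
      = if a = b then
        2 ^ (n - (a : ℕ)) - ∑ i : Fin n, (2 ^ (n - (i : ℕ)) : ℂ) * (1 / n) else 0 := by
  have h : (binaryElement n : Matrix (Fin n) (Fin n) ℂ)
      = ∑ i : Fin n, (2 ^ (n - (i : ℕ)) : ℂ) • XMat n i i := by
    rw [binaryElement, AddSubmonoidClass.coe_finsetSum]
    rfl
  rw [h, Matrix.sum_apply]
  simp only [Matrix.smul_apply, XMat_apply, smul_eq_mul, true_and, mul_sub]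
  by_cases hab : a = b
  · subst hab
    simp [Finset.sum_sub_distrib]
  · have : ∀ i : Fin n, ¬ (i = a ∧ i = b) := fun i hi => hab (hi.1.symm.trans hi.2)
    simp [hab, this]

/-- The eigenvalue of `binaryElement` on a multi-index. -/
def binaryWeight (t : ι → Fin n) : ℂ :=
  ∑ p, (binaryElement n : Matrix (Fin n) (Fin n) ℂ) (t p) (t p)

theorem act_binaryElement (F : Fn n ι) (t : ι → Fin n) :
    act (binaryElement n : Matrix (Fin n) (Fin n) ℂ) F t = binaryWeight t * F t :=
  act_diagonal (fun i j hij => by rw [binaryElement_apply, if_neg hij]) F t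

/-- After the common trace term cancels, both sides are sums of different powers of 2, so uniqueness
of binary expansions gives equal sets of indices. -/
theorem exists_perm_of_binaryWeight_eq {s t : ι → Fin n} (hs : Function.Injective s)
    (ht : Function.Injective t) (h : binaryWeight t = binaryWeight s) :
    ∃ σ : Equiv.Perm ι, t = s ∘ σ := by
  have h1 : ∑ p, (2 ^ (n - (t p : ℕ)) : ℂ) = ∑ p, (2 ^ (n - (s p : ℕ)) : ℂ) := by
    simpa [binaryWeight, binaryElement_apply, Finset.sum_sub_distrib] using h
  have h2 : ∑ p, 2 ^ (n - (t p : ℕ)) = ∑ p, 2 ^ (n - (s p : ℕ)) := by exact_mod_cast h1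
  have hinj : ∀ u : ι → Fin n, Function.Injective u →
      Function.Injective fun p => n - (u p : ℕ) := by
    intro u hu p q hpq
    refine hu (Fin.ext ?_)
    have := (u p).2
    have := (u q).2
    simp only at hpq
    omega
  have himg : Finset.univ.image (fun p => n - (t p : ℕ))
      = Finset.univ.image fun p => n - (s p : ℕ) := by
    apply Finset.geomSum_injective le_rfl
    simp only
    rw [Finset.sum_image fun p _ q _ hpq => hinj t ht hpq,
      Finset.sum_image fun p _ q _ hpq => hinj s hs hpq]
    exact h2
  have hex : ∀ p, ∃ q, t p = s q := by
    intro p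
    have hp : n - (t p : ℕ) ∈ Finset.univ.image fun p => n - (s p : ℕ) := by
      rw [← himg]
      exact Finset.mem_image_of_mem _ (Finset.mem_univ p)
    obtain ⟨q, -, hq⟩ := Finset.mem_image.1 hp
    refine ⟨q, Fin.ext ?_⟩
    have := (t p).2
    have := (s q).2
    omega
  choose f hf using hex
  have hfinj : Function.Injective f := fun p q hpq => ht (by rw [hf, hf, hpq])
  exact ⟨Equiv.ofBijective f (Finite.injective_iff_bijective.1 hfinj), funext hf⟩

variable {l : Weight n} {j : V l →ₗ[Env n] Fn n ι}

/-- The operator of `binaryElement` on `V_l`. -/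
def binaryOp (l : Weight n) : Module.End ℂ (V l) := LieModule.toEnd ℂ (𝔰𝔩 n) (V l) (binaryElement n)

theorem map_binaryOp (j : V l →ₗ[Env n] Fn n ι) (x : V l) (t : ι → Fin n) :
    j (binaryOp l x) t = binaryWeight t * j x t := by
  rw [← act_binaryElement, ← map_lie_eq_act]
  rfl

theorem map_aeval_binaryOp (j : V l →ₗ[Env n] Fn n ι) (p : Polynomial ℂ) (x : V l)
    (t : ι → Fin n) :
    j (Polynomial.aeval (binaryOp l) p x) t = p.eval (binaryWeight t) * j x t := by
  induction p using Polynomial.induction_on' with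
  | add p q hp hq =>
    rw [map_add, LinearMap.add_apply, map_add, Fn.add_apply, hp, hq, Polynomial.eval_add, add_mul]
  | monomial k a =>
    have hk : j ((binaryOp l ^ k) x) t = binaryWeight t ^ k * j x t := by
      induction k with
      | zero => simp
      | succ k ih => rw [pow_succ', Module.End.mul_apply, map_binaryOp, ih, pow_succ', mul_assoc]
    rw [Polynomial.aeval_monomial, Module.End.mul_apply, Module.algebraMap_end_apply,
      LinearMap.map_smul_of_tower, Fn.smul_apply, hk, Polynomial.eval_monomial, mul_assoc]

/-- The operator is diagonal in the model with finitely many values, so the Lagrange basis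
polynomials evaluated at it are projections onto its eigenspaces. -/
theorem iSup_eigenspace_binaryOp (hj : Function.Injective j) :
    ⨆ μ, (binaryOp l).eigenspace μ = ⊤ := by
  refine eq_top_iff.2 fun x _ => ?_
  by_cases hne : (Finset.univ.image fun t : ι → Fin n => binaryWeight t).Nonempty
  · have hx : x = ∑ μ ∈ Finset.univ.image fun t : ι → Fin n => binaryWeight t,
        Polynomial.aeval (binaryOp l) (Lagrange.basis
          (Finset.univ.image fun t : ι → Fin n => binaryWeight t) id μ) x := by
      rw [← LinearMap.sum_apply, ← map_sum, Lagrange.sum_basis Function.injective_id.injOn hne,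
        map_one, Module.End.one_apply]
    rw [hx]
    refine Submodule.sum_mem _ fun μ hμ => Submodule.mem_iSup_of_mem μ ?_
    refine Module.End.mem_eigenspace_iff.2 (hj ?_)
    funext t
    rw [map_binaryOp, LinearMap.map_smul_of_tower, Fn.smul_apply, map_aeval_binaryOp]
    by_cases ht : binaryWeight t = μ
    · rw [ht]
    · have := Lagrange.eval_basis_of_ne (v := id) (Ne.symm ht)
        (Finset.mem_image_of_mem (fun t : ι → Fin n => binaryWeight t) (Finset.mem_univ t))
      rw [id] at this
      rw [this]
      ring
  · have hx : x = 0 := by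
      refine hj ?_
      rw [map_zero]
      funext t
      exact absurd ⟨_, Finset.mem_image_of_mem _ (Finset.mem_univ t)⟩ hne
    rw [hx]
    exact Submodule.zero_mem _

/-- An antisymmetric eigenvector is supported on the rearrangements of one injective multi-index s,
and its value at s determines it. So the eigenspaces are at most one-dimensional. -/
theorem mem_span_of_mem_eigenspace (hj : Function.Injective j)
    (halt : ∀ x, j x ∈ alternating n ι) {μ : ℂ} {x y : V l} (hx0 : x ≠ 0)
    (hx : x ∈ (binaryOp l).eigenspace μ) (hy : y ∈ (binaryOp l).eigenspace μ) :
    y ∈ Submodule.span ℂ {x} := by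
  have hsupp : ∀ z ∈ (binaryOp l).eigenspace μ, ∀ t, j z t ≠ 0 → binaryWeight t = μ := by
    intro z hz t ht
    have h1 := map_binaryOp j z t
    rw [Module.End.mem_eigenspace_iff.1 hz, LinearMap.map_smul_of_tower, Fn.smul_apply] at h1
    exact (mul_right_cancel₀ ht h1).symm
  obtain ⟨s, hs⟩ : ∃ s, j x s ≠ 0 := by
    by_contra! h
    exact hx0 (hj (by rw [map_zero]; exact funext h))
  refine Submodule.mem_span_singleton.2 ⟨j y s / j x s, hj ?_⟩
  funext t
  rw [LinearMap.map_smul_of_tower, Fn.smul_apply]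
  by_cases ht : binaryWeight t = μ ∧ Function.Injective t
  · obtain ⟨σ, rfl⟩ := exists_perm_of_binaryWeight_eq (injective_of_ne_zero (halt x) hs) ht.2
      (ht.1.trans (hsupp x hx s hs).symm)
    rw [halt x, halt y]
    field_simp
  · have h0 : ∀ z ∈ (binaryOp l).eigenspace μ, j z t = 0 := by
      intro z hz
      by_contra hne
      exact ht ⟨hsupp z hz t hne, injective_of_ne_zero (halt z) hne⟩
    rw [h0 x hx, h0 y hy, mul_zero]

/-- The antisymmetric module has a basis of eigenvectors with different eigenvalues. -/
theorem exists_basis_binaryOp [FiniteDimensional ℂ (V l)] (hj : Function.Injective j)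
    (halt : ∀ x, j x ∈ alternating n ι) :
    ∃ (b : Module.Basis (Fin (Module.finrank ℂ (V l))) ℂ (V l))
      (μ : Fin (Module.finrank ℂ (V l)) → ℂ), Function.Injective μ ∧
      ∀ i, binaryOp l (b i) = μ i • b i := by
  have hex : ∀ μ : (binaryOp l).Eigenvalues, ∃ x, (binaryOp l).HasEigenvector (μ : ℂ) x := fun μ =>
    Module.End.HasEigenvalue.exists_hasEigenvector μ.2
  choose x hx using hex
  have hli := Module.End.eigenvectors_linearIndependent' (binaryOp l)
    (fun μ : (binaryOp l).Eigenvalues => (μ : ℂ)) Subtype.val_injective x hx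
  have hspan : ⊤ ≤ Submodule.span ℂ (Set.range x) := by
    rw [← iSup_eigenspace_binaryOp hj]
    refine iSup_le fun μ y hy => ?_
    by_cases hy0 : y = 0
    · rw [hy0]; exact Submodule.zero_mem _
    · have hμ : (binaryOp l).HasEigenvalue μ := Module.End.hasEigenvalue_of_hasEigenvector ⟨hy, hy0⟩
      have := mem_span_of_mem_eigenspace hj halt (hx ⟨μ, hμ⟩).2 (hx ⟨μ, hμ⟩).1 hy
      exact Submodule.span_mono (Set.singleton_subset_iff.2 (Set.mem_range_self _)) this
  let b := Module.Basis.mk hli hspan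
  let e := Fintype.equivFinOfCardEq (Module.finrank_eq_card_basis b).symm
  refine ⟨b.reindex e, fun i => (e.symm i : ℂ), Subtype.val_injective.comp e.symm.injective,
    fun i => ?_⟩
  rw [Module.Basis.reindex_apply, Module.Basis.mk_apply]
  exact Module.End.mem_eigenspace_iff.1 (hx _).1

/-- In an antisymmetric tensor the index m occurs at most once, so X_mm has eigenvalues ε - a with
ε² = ε and a = |ι| / n. This makes the quadratic part of the Casimir linear on V_l, and the linear
term disappears in the sum over m because ∑ X_mm = 0. -/
theorem lie_lie_X_diag (hj : Function.Injective j) (halt : ∀ x, j x ∈ alternating n ι) (m : Fin n)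
    (x : V l) : ⁅X n m m, ⁅X n m m, x⁆⁆ =
      (1 - 2 * (Fintype.card ι / n : ℂ)) • ⁅X n m m, x⁆
        + ((Fintype.card ι / n : ℂ) - (Fintype.card ι / n : ℂ) ^ 2) • x := by
  refine hj ?_
  funext t
  have hX : ∀ F : Fn n ι, act ((X n m m : 𝔰𝔩 n) : Matrix (Fin n) (Fin n) ℂ) F t
      = ((∑ p, if m = t p then 1 else 0) - (Fintype.card ι / n : ℂ)) * F t := by
    intro F
    rw [act_diagonal (X_diag_mem n m)]
    simp [X, XMat_apply, Finset.sum_sub_distrib, div_eq_mul_inv]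
  rw [map_add, Fn.add_apply, LinearMap.map_smul_of_tower, LinearMap.map_smul_of_tower,
    Fn.smul_apply, Fn.smul_apply, map_lie_eq_act, hX, map_lie_eq_act, hX]
  by_cases ht : j x t = 0
  · rw [ht]; ring
  · have hinj := injective_of_ne_zero (halt x) ht
    have hN : (∑ p, if m = t p then (1 : ℂ) else 0) ^ 2 = ∑ p, if m = t p then (1 : ℂ) else 0 := by
      by_cases hex : ∃ p, m = t p
      · obtain ⟨p, rfl⟩ := hex
        rw [Finset.sum_eq_single p]
        · simp
        · intro q _ hq
          rw [if_neg fun h => hq (hinj h).symm]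
        · simp
      · have : ∀ p, ¬ m = t p := fun p hp => hex ⟨p, hp⟩
        simp [this]
    linear_combination (j x t) * hN

end Alternating

/-! ### Pairing with the singular vectors of the tensor product -/

section Blocks

set_option linter.unusedSectionVars false

variable {n : ℕ} {B : Type} [Fintype B] [DecidableEq B] (size : B → Fin n)

/-- The positions of a family of blocks of the given sizes. -/
abbrev BlockPos : Type := Σ b : B, Fin (size b : ℕ)

/-- The label of a position in a block. -/
def blockLabel (q : BlockPos size) : Fin n := ⟨q.2, q.2.2.trans (size q.1).2⟩

theorem isLabelling_block : IsLabelling (fun q : BlockPos size => q.1) (blockLabel size) where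
  inj := by
    rintro ⟨b, x⟩ ⟨b', x'⟩ h h'
    obtain rfl : b = b' := h
    congr 1
    exact Fin.ext (congrArg (fun i : Fin n => (i : ℕ)) h')
  initial := by
    rintro ⟨b, x⟩ i hi
    exact ⟨⟨b, ⟨i, lt_of_le_of_lt (Fin.le_def.1 hi) x.2⟩⟩, rfl, rfl⟩

variable {size} {ι : Type} [Fintype ι] [DecidableEq ι] {s : ι → Fin n} {bl : ι → B}

/-- A block of size m carries the labels 0, …, m - 1, so one more box with label m keeps an initial
segment. Injectivity of `bl` ensures that no block receives two boxes. -/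
theorem isLabelling_sum (hbl : Function.Injective bl) (hs : ∀ r, size (bl r) = s r) :
    IsLabelling (Sum.elim bl fun q : BlockPos size => q.1) (Sum.elim s (blockLabel size)) where
  inj := by
    have hne : ∀ (r : ι) (q : BlockPos size), bl r = q.1 → s r ≠ blockLabel size q := by
      rintro r q h h'
      have h1 : blockLabel size q < size q.1 := q.2.2
      rw [← h, hs, h'] at h1
      exact lt_irrefl _ h1
    rintro (r | q) (r' | q') h h'
    · exact congrArg _ (hbl h)
    · exact absurd h' (hne r q' h)
    · exact absurd h'.symm (hne r' q h.symm)
    · exact congrArg _ ((isLabelling_block size).inj q q' h h')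
  initial := by
    rintro (r | q) i hi
    · rcases eq_or_lt_of_le hi with h | h
      · exact ⟨Sum.inl r, rfl, h.symm⟩
      · exact ⟨Sum.inr ⟨bl r, ⟨i, by rw [hs]; exact h⟩⟩, rfl, rfl⟩
    · obtain ⟨q', h, h'⟩ := (isLabelling_block size).initial q i hi
      exact ⟨Sum.inr q', h, h'⟩

/-- Where the first determinant is nonzero, every entry of t is below the size of its block, whereas
the new columns carry the size itself as label. The large matrix is then block triangular, with a
diagonal corner comparing u with s. -/
theorem detVec_mul_detVec_sum (hbl : Function.Injective bl) (hs : ∀ r, size (bl r) = s r)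
    (u : ι → Fin n) (t : BlockPos size → Fin n) :
    detVec (fun q : BlockPos size => q.1) (blockLabel size) t
        * detVec (Sum.elim bl fun q : BlockPos size => q.1) (Sum.elim s (blockLabel size))
          (Sum.elim u t)
      = if u = s then detVec (fun q : BlockPos size => q.1) (blockLabel size) t
          * detVec (fun q : BlockPos size => q.1) (blockLabel size) t else 0 := by
  by_cases hvalid : ∀ q : BlockPos size, t q < size q.1
  · have hmat : (Matrix.of fun p q : ι ⊕ BlockPos size =>
        if (Sum.elim bl fun q : BlockPos size => q.1) p
            = (Sum.elim bl fun q : BlockPos size => q.1) q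
          ∧ Sum.elim u t p = Sum.elim s (blockLabel size) q then (1 : ℂ) else 0)
        = Matrix.fromBlocks (Matrix.diagonal fun r => if u r = s r then (1 : ℂ) else 0)
          (Matrix.of fun r q => if bl r = q.1 ∧ u r = blockLabel size q then (1 : ℂ) else 0) 0
          (Matrix.of fun p q : BlockPos size =>
            if p.1 = q.1 ∧ t p = blockLabel size q then (1 : ℂ) else 0) := by
      ext p q
      rcases p with r | p <;> rcases q with r' | q
      · by_cases hr : r = r'
        · subst hr; simp
        · have : ¬ bl r = bl r' := fun h => hr (hbl h)
          simp [hr, this]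
      · exact if_congr Iff.rfl rfl rfl
      · have : ¬ (p.1 = bl r' ∧ t p = s r') := by
          rintro ⟨h, h'⟩
          have h1 := hvalid p
          rw [h, hs, h'] at h1
          exact lt_irrefl _ h1
        exact if_neg this
      · exact if_congr Iff.rfl rfl rfl
    have hdet : detVec (Sum.elim bl fun q : BlockPos size => q.1) (Sum.elim s (blockLabel size))
        (Sum.elim u t) = (∏ r, if u r = s r then (1 : ℂ) else 0)
          * detVec (fun q : BlockPos size => q.1) (blockLabel size) t := by
      rw [detVec, hmat, Matrix.det_fromBlocks_zero₂₁, Matrix.det_diagonal]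
      rfl
    rw [hdet]
    split_ifs with hus
    · subst hus; simp
    · obtain ⟨r, hr⟩ := Function.ne_iff.1 hus
      rw [Finset.prod_eq_zero (Finset.mem_univ r) (if_neg hr), zero_mul, mul_zero]
  -- An entry not below its block size matches no label of the block, which gives a zero row.
  · push Not at hvalid
    obtain ⟨p, hp⟩ := hvalid
    have h0 : detVec (fun q : BlockPos size => q.1) (blockLabel size) t = 0 := by
      refine Matrix.det_eq_zero_of_row_eq_zero p fun q => ?_
      rw [Matrix.of_apply, if_neg]
      rintro ⟨h, h'⟩
      rw [h', show p.1 = q.1 from h] at hp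
      exact absurd q.2.2 (not_lt.2 hp)
    rw [h0]
    simp

/-- The pairing of `F ⊗ w` with a singular vector extracts a coefficient of `F`. -/
theorem pair_detVec_sum (hbl : Function.Injective bl) (hs : ∀ r, size (bl r) = s r) (F : Fn n ι) :
    pair (fun t => F (t ∘ Sum.inl) * detVec (fun q : BlockPos size => q.1) (blockLabel size)
        (t ∘ Sum.inr) : Fn n (ι ⊕ BlockPos size))
      (detVec (Sum.elim bl fun q : BlockPos size => q.1) (Sum.elim s (blockLabel size)))
      = F s * pair (detVec (fun q : BlockPos size => q.1) (blockLabel size))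
          (detVec (fun q : BlockPos size => q.1) (blockLabel size)) := by
  unfold pair
  rw [← (Equiv.sumArrowEquivProdArrow ι (BlockPos size) (Fin n)).symm.sum_comp,
    Fintype.sum_prod_type, Finset.sum_eq_single s]
  · rw [Finset.mul_sum]
    refine Finset.sum_congr rfl fun t _ => ?_
    have := detVec_mul_detVec_sum hbl hs s t
    rw [if_pos rfl] at this
    rw [← this, ← mul_assoc]
    rfl
  · intro u _ hu
    refine Finset.sum_eq_zero fun t _ => ?_
    have := detVec_mul_detVec_sum hbl hs u t
    rw [if_neg hu] at this
    change F u * detVec (fun q : BlockPos size => q.1) (blockLabel size) t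
      * detVec (Sum.elim bl fun q : BlockPos size => q.1) (Sum.elim s (blockLabel size))
          (Sum.elim u t) = 0
    rw [mul_assoc, this, mul_zero]
  · simp

theorem pair_detVec_self_ne_zero :
    pair (detVec (fun q : BlockPos size => q.1) (blockLabel size))
      (detVec (fun q : BlockPos size => q.1) (blockLabel size)) ≠ 0 := by
  intro h
  refine detVec_ne_zero (isLabelling_block size) (pair_conj_self_eq_zero ?_)
  rwa [conj_detVec]

end Blocks

/-! ### The dominant weight ν and its coordinates -/

section HighWeight

/-- An index set with `2^{n-m} - 1` blocks of size `m`. -/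
abbrev BinaryBlocks (n : ℕ) : Type := Σ m : Fin n, Fin (2 ^ (n - (m : ℕ)) - 1)

/-- The dominant weight `∑ (2^{n-m} - 1) ω_m`. -/
def binaryDominant (n : ℕ) : Weight n :=
  labelWeight (blockLabel fun b : BinaryBlocks n => b.1)

theorem sum_two_pow_sub_one (r : ℕ) :
    ∑ m ∈ Finset.range r, ((2 : ℂ) ^ (m + 1) - 1) = 2 ^ (r + 1) - 2 - r := by
  induction r with
  | zero => norm_num
  | succ r ih =>
    rw [Finset.sum_range_succ, ih]
    push_cast
    ring

/-- Label i occurs once in each block of size m > i, so the count is ∑_{m > i} (2^{n-m} - 1). The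
summands -1 produce the term linear in i that later cancels against ρ. -/
theorem sum_label_eq {n : ℕ} (i : Fin n) :
    ∑ q : BlockPos fun b : BinaryBlocks n => b.1,
      (if i = blockLabel (fun b : BinaryBlocks n => b.1) q then (1 : ℂ) else 0)
      = 2 ^ (n - (i : ℕ)) + (i : ℕ) - n - 1 := by
  have h1 : ∀ m : Fin n, ∑ x : Fin (m : ℕ), (if (i : ℕ) = x then (1 : ℂ) else 0)
      = if (i : ℕ) < m then 1 else 0 := by
    intro m
    by_cases h : (i : ℕ) < m
    · rw [if_pos h, Finset.sum_eq_single ⟨i, h⟩]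
      · simp
      · intro x _ hx
        rw [if_neg fun hi => hx (Fin.ext hi.symm)]
      · simp
    · rw [if_neg h]
      exact Finset.sum_eq_zero fun x _ => if_neg fun hi => h (lt_of_eq_of_lt hi x.2)
  have h2 : ∑ q : BlockPos fun b : BinaryBlocks n => b.1,
      (if i = blockLabel (fun b : BinaryBlocks n => b.1) q then (1 : ℂ) else 0)
      = ∑ m : Fin n, if (i : ℕ) < m then (2 : ℂ) ^ (n - (m : ℕ)) - 1 else 0 := by
    simp only [Fintype.sum_sigma, blockLabel, Fin.ext_iff, h1]
    refine Finset.sum_congr rfl fun m _ => ?_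
    change ∑ _x : Fin (2 ^ (n - (m : ℕ)) - 1), (if (i : ℕ) < m then (1 : ℂ) else 0) = _
    rw [Finset.sum_const, Finset.card_univ, Fintype.card_fin, nsmul_eq_mul,
      Nat.cast_sub Nat.one_le_two_pow]
    split_ifs <;> simp
  have hi := i.2
  rw [h2, Fin.sum_univ_eq_sum_range (fun m => if (i : ℕ) < m then (2 : ℂ) ^ (n - m) - 1 else 0) n,
    ← Finset.sum_range_reflect]
  have h3 : ∑ m ∈ Finset.range n,
      (if (i : ℕ) < n - 1 - m then (2 : ℂ) ^ (n - (n - 1 - m)) - 1 else 0)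
      = ∑ m ∈ Finset.range (n - 1 - i), ((2 : ℂ) ^ (m + 1) - 1) := by
    rw [← Finset.sum_filter]
    have : (Finset.range n).filter (fun m => (i : ℕ) < n - 1 - m) = Finset.range (n - 1 - i) := by
      ext m
      simp only [Finset.mem_filter, Finset.mem_range]
      omega
    rw [this]
    refine Finset.sum_congr rfl fun m hm => ?_
    rw [Finset.mem_range] at hm
    rw [show n - (n - 1 - m) = m + 1 by omega]
  rw [h3, sum_two_pow_sub_one, show n - 1 - (i : ℕ) + 1 = n - i by omega, Nat.cast_sub (by omega),
    Nat.cast_sub (by omega)]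
  push_cast
  ring

theorem exists_binaryDominant_XDiag (n : ℕ) :
    ∃ K : ℂ, ∀ i : Fin n, binaryDominant n (XDiag n i) = 2 ^ (n - (i : ℕ)) + (i : ℕ) + K := by
  refine ⟨- n - 1 - (Fintype.card (BlockPos fun b : BinaryBlocks n => b.1)) * (1 / n), fun i => ?_⟩
  have : binaryDominant n (XDiag n i) = ∑ q : BlockPos fun b : BinaryBlocks n => b.1,
      ((if i = blockLabel (fun b : BinaryBlocks n => b.1) q then (1 : ℂ) else 0) - 1 / n) := by
    refine Finset.sum_congr rfl fun q _ => ?_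
    change XMat n i i _ _ = _
    simp [XMat_apply]
  rw [this, Finset.sum_sub_distrib, sum_label_eq, Finset.sum_const, Finset.card_univ, nsmul_eq_mul]
  ring

theorem isDominant_binaryDominant (n : ℕ) : IsDominant (binaryDominant n) := by
  intro i j hij
  obtain ⟨K, hK⟩ := exists_binaryDominant_XDiag n
  refine ⟨2 ^ (n - (j : ℕ)) - 1, ?_⟩
  have hj := j.2
  rw [map_sub, hK, hK, Nat.cast_sub Nat.one_le_two_pow, show n - (i : ℕ) = n - j + 1 by omega, hij]
  push_cast
  ring

theorem fundWeight_eq_labelWeight {n k : ℕ} (hkn : k ≤ n) :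
    fundWeight n k = labelWeight (Fin.castLE hkn) := by
  refine LinearMap.ext fun h => ?_
  change ∑ i ∈ Finset.univ.filter (fun i : Fin n => (i : ℕ) < k),
    ((h : 𝔰𝔩 n) : Matrix (Fin n) (Fin n) ℂ) i i
    = ∑ q : Fin k, ((h : 𝔰𝔩 n) : Matrix (Fin n) (Fin n) ℂ) (Fin.castLE hkn q) (Fin.castLE hkn q)
  have : Finset.univ.filter (fun i : Fin n => (i : ℕ) < k)
      = Finset.univ.map (Fin.castLEEmb hkn) := by
    ext i
    simp only [Finset.mem_filter, Finset.mem_univ, true_and, Finset.mem_map]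
    constructor
    · intro hi
      exact ⟨⟨i, hi⟩, rfl⟩
    · rintro ⟨q, rfl⟩
      exact q.2
  rw [this, Finset.sum_map]
  rfl

theorem isLabelling_castLE {n k : ℕ} (hkn : k ≤ n) :
    IsLabelling (fun _ : Fin k => ()) (Fin.castLE hkn) where
  inj _ _ _ h := Fin.castLE_injective hkn h
  initial q i hi := ⟨⟨i, lt_of_le_of_lt (Fin.le_def.1 hi) q.2⟩, rfl, rfl⟩

end HighWeight

/-! ### The Casimir on the coinvariants of V_l ⊗ V_ν -/

section Separation

variable {n : ℕ} {ι : Type} [Fintype ι] [DecidableEq ι] {l ν : Weight n}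

theorem vermaRadical_ne_top {w : Fn n ι} (hw : IsSingular ν w) (hr : conj w = w) (hw0 : w ≠ 0) :
    vermaRadical ν ≠ ⊤ := by
  intro h
  rw [vermaRadical_eq_ker hw hr hw0, LinearMap.ker_eq_top] at h
  refine hw0 ?_
  rw [← vermaMap_vermaVec hw, h, LinearMap.zero_apply]

theorem lie_X_diag_tmul (i : Fin n) (x : V l) : ⁅X n i i, x ⊗ₜ[ℂ] highestVec ν⁆
    = ⁅X n i i, x⁆ ⊗ₜ[ℂ] highestVec ν + ν (XDiag n i) • (x ⊗ₜ[ℂ] highestVec ν) := by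
  have h : ⁅X n i i, highestVec ν⁆ = ν (XDiag n i) • highestVec ν :=
    (isSingular_highestVec ν).cartan (XDiag n i)
  rw [TensorProduct.LieModule.lie_tmul_right, h, TensorProduct.tmul_smul]

/-- This is the expansion of the Casimir value of ν + γ: the part depending on γ is 2⟨ν + ρ, γ⟩, and
by the choice of ν it is twice the eigenvalue μ of `binaryElement`. -/
theorem casimir_two_tmul {j : V l →ₗ[Env n] Fn n ι} (hj : Function.Injective j)
    (halt : ∀ x, j x ∈ alternating n ι) {K : ℂ}
    (hK : ∀ i : Fin n, ν (XDiag n i) = 2 ^ (n - (i : ℕ)) + (i : ℕ) + K) {x : V l} {μ : ℂ}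
    (hx : binaryOp l x = μ • x) :
    envAction n (V l ⊗[ℂ] V ν) (casimir n 2) (x ⊗ₜ highestVec ν)
      - (2 * μ + ∑ i : Fin n, ((Fintype.card ι / n : ℂ) - (Fintype.card ι / n : ℂ) ^ 2
        + ν (XDiag n i) ^ 2 + ((n : ℂ) - 1 - 2 * (i : ℕ)) * ν (XDiag n i)))
        • (x ⊗ₜ[ℂ] highestVec ν)
      ∈ lowered (lowering n) (⊤ : LieSubmodule ℂ (𝔰𝔩 n) (V l ⊗[ℂ] V ν)) := by
  set a : ℂ := Fintype.card ι / n with ha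
  set t := x ⊗ₜ[ℂ] highestVec ν with ht
  set A : Fin n → V l ⊗[ℂ] V ν := fun i => ⁅X n i i, x⁆ ⊗ₜ[ℂ] highestVec ν with hA
  have hA0 : ∑ i, A i = 0 := by
    rw [hA, ← TensorProduct.sum_tmul, ← sum_lie, sum_X_diag, zero_lie, TensorProduct.zero_tmul]
  have hAμ : ∑ i : Fin n, (2 ^ (n - (i : ℕ)) : ℂ) • A i = μ • t := by
    simp only [hA, TensorProduct.smul_tmul']
    rw [← TensorProduct.sum_tmul, ht, TensorProduct.smul_tmul', ← hx]
    congr 1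
    change _ = ⁅binaryElement n, x⁆
    rw [binaryElement, sum_lie]
    simp only [smul_lie]
  have hterm : ∀ i : Fin n, ⁅X n i i, ⁅X n i i, t⁆⁆ + ((n : ℂ) - 1 - 2 * (i : ℕ)) • ⁅X n i i, t⁆
      = (2 : ℂ) • ((2 ^ (n - (i : ℕ)) : ℂ) • A i) + (2 * K + n - 2 * a) • A i
        + (a - a ^ 2 + ν (XDiag n i) ^ 2 + ((n : ℂ) - 1 - 2 * (i : ℕ)) * ν (XDiag n i)) • t := by
    intro i
    have h1 : ⁅X n i i, t⁆ = A i + ν (XDiag n i) • t := lie_X_diag_tmul i x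
    have h2 : ⁅X n i i, A i⁆ = (1 - 2 * a) • A i + (a - a ^ 2) • t + ν (XDiag n i) • A i := by
      rw [hA, ht]
      simp only
      rw [lie_X_diag_tmul, lie_lie_X_diag hj halt, TensorProduct.add_tmul,
        ← TensorProduct.smul_tmul', ← TensorProduct.smul_tmul']
    -- The coefficient of A i is (1 - 2a) + 2 ν(X_ii) + (n - 1 - 2i). The summand i of ν(X_ii)
    -- cancels the -2i from ρ, leaving 2 · 2^{n-i} plus a constant, and the constant drops out since
    -- ∑ A i = 0.
    rw [h1, lie_add, lie_smul, h1, h2, hK i]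
    module
  have hsum := envAction_casimir_two_sub_mem (n := n) t
  rw [← Finset.sum_add_distrib, Finset.sum_congr rfl fun i _ => hterm i, Finset.sum_add_distrib,
    Finset.sum_add_distrib, ← Finset.smul_sum, ← Finset.smul_sum, ← Finset.sum_smul, hA0, hAμ,
    smul_zero, add_zero, smul_smul, ← add_smul] at hsum
  exact hsum

theorem M_apply_of_scalars {z : Env n} {a b : ℂ} (ha : ∀ x, envAction n (V l) z x = a • x)
    (hb : ∀ y, envAction n (V ν) z y = b • y) (t : V l ⊗[ℂ] V ν) :
    M l ν z t = envAction n (V l ⊗[ℂ] V ν) z t - (a + b) • t := by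
  have ha' : envAction n (V l) z = a • LinearMap.id := LinearMap.ext ha
  have hb' : envAction n (V ν) z = b • LinearMap.id := LinearMap.ext hb
  rw [M, ha', hb', TensorProduct.map_smul_left, TensorProduct.map_smul_right, TensorProduct.map_id]
  simp only [LinearMap.sub_apply, LinearMap.smul_apply, LinearMap.id_apply]
  module

theorem simpleCoinvariants_tensor {size : BinaryBlocks n → Fin n} (hsize : size = fun b => b.1)
    {j₁ : V l →ₗ[Env n] Fn n ι} (hj₁ : Function.Injective j₁)
    (halt : ∀ x, j₁ x ∈ alternating n ι) {j₂ : V ν →ₗ[Env n] Fn n (BlockPos size)}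
    (hj₂ : Function.Injective j₂)
    (hvec : j₂ (highestVec ν) = detVec (fun q : BlockPos size => q.1) (blockLabel size))
    {K : ℂ} (hK : ∀ i : Fin n, ν (XDiag n i) = 2 ^ (n - (i : ℕ)) + (i : ℕ) + K)
    {J : Type*} (b : Module.Basis J ℂ (V l)) {μ : J → ℂ} (hμ : Function.Injective μ)
    (hb : ∀ i, binaryOp l (b i) = μ i • b i) :
    ∃ r : ℂ, SimpleCoinvariants (lowering n) (envAction n (V l ⊗[ℂ] V ν) (casimir n 2))
      (fun i => b i ⊗ₜ[ℂ] highestVec ν) (fun i => 2 * μ i + r) := by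
  have hinj := tensorEmbed_injective hj₁ hj₂
  refine ⟨_,
    { exists_isCompl := exists_isCompl_of_embedding hinj (tensorEmbed_lie j₁ j₂)
      eq_bot := eq_bot_of_le_lowered hinj (tensorEmbed_lie j₁ j₂)
      comm := envAction_casimir_lie 2
      mem := fun N => envAction_mem N _
      injective := fun i i' h => hμ (by linear_combination h / 2)
      span := span_tmul_sup_lowered b
      eigen := fun i => casimir_two_tmul hj₁ halt hK (hb i)
      notMem := ?_ }⟩
  intro i hi
  obtain ⟨s, hs⟩ : ∃ s, j₁ (b i) s ≠ 0 := by
    by_contra! h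
    exact b.ne_zero i (hj₁ (by rw [map_zero]; exact funext h))
  have hsinj := injective_of_ne_zero (halt (b i)) hs
  -- Each index s r extends block number 0 of size s r. That block exists since 2^{n-m} - 1 ≥ 1 for
  -- m < n, and the empty blocks of size 0 serve the index 0.
  let bl : ι → BinaryBlocks n := fun r => ⟨s r, ⟨0, by
    have := (s r).2
    have := Nat.one_lt_two_pow (show n - (s r : ℕ) ≠ 0 by omega)
    omega⟩⟩
  have hbl : Function.Injective bl := fun r r' h => hsinj (congrArg Sigma.fst h)
  have hsz : ∀ r, size (bl r) = s r := fun r => by rw [hsize]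
  have h0 := pair_eq_zero_of_mem_lowered (tensorEmbed_lie j₁ j₂)
    (isSingular_detVec (isLabelling_sum hbl hsz)) hi
  have h1 : tensorEmbed j₁ j₂ (b i ⊗ₜ[ℂ] highestVec ν) = fun t => j₁ (b i) (t ∘ Sum.inl)
      * detVec (fun q : BlockPos size => q.1) (blockLabel size) (t ∘ Sum.inr) := by
    funext t
    rw [tensorEmbed_tmul, hvec]
  rw [h1, pair_detVec_sum hbl hsz] at h0
  exact mul_ne_zero hs pair_detVec_self_ne_zero h0

end Separation

end SLTensor

end

/-! ### The main theorem -/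

theorem corollary6p3 (n k : ℕ) (hk : 1 ≤ k) (hkn : k ≤ n - k) :
    ∃ ν : SLTensor.Weight n, SLTensor.IsDominant ν ∧
      SLTensor.TotallySubordinate (SLTensor.fundWeight n k) ν ∧
      SLTensor.SeparatedBy n (fun p : Finset.Icc 2 (k + 1) =>
        SLTensor.M (SLTensor.fundWeight n k) ν (SLTensor.casimir n p)) := by
  open SLTensor in
  have hkn' : k ≤ n := hkn.trans (Nat.sub_le n k)
  have hl : IsLabelling (fun _ : Fin k => ()) (Fin.castLE hkn') := isLabelling_castLE hkn'
  have hw₁ : IsSingular (fundWeight n k) (detVec (fun _ : Fin k => ()) (Fin.castLE hkn')) := by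
    rw [fundWeight_eq_labelWeight hkn']
    exact isSingular_detVec hl
  have hr₁ := conj_detVec (fun _ : Fin k => ()) (Fin.castLE hkn')
  have hl₂ := isLabelling_block (fun b : BinaryBlocks n => b.1)
  have hw₂ : IsSingular (binaryDominant n) _ := isSingular_detVec hl₂
  have hr₂ := conj_detVec (fun q : BlockPos (fun b : BinaryBlocks n => b.1) => q.1)
    (blockLabel fun b : BinaryBlocks n => b.1)
  set j₁ := embed hw₁ hr₁ (detVec_ne_zero hl) with hj₁def
  have hj₁ : Function.Injective j₁ := embed_injective _ _ _
  set j₂ := embed hw₂ hr₂ (detVec_ne_zero hl₂) with hj₂def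
  have hj₂ : Function.Injective j₂ := embed_injective _ _ _
  have : FiniteDimensional ℂ (V (fundWeight n k)) :=
    FiniteDimensional.of_injective (j₁.restrictScalars ℂ) hj₁
  have : FiniteDimensional ℂ (V (binaryDominant n)) :=
    FiniteDimensional.of_injective (j₂.restrictScalars ℂ) hj₂
  have := isIrreducible_V (vermaRadical_ne_top hw₁ hr₁ (detVec_ne_zero hl))
  have := isIrreducible_V (vermaRadical_ne_top hw₂ hr₂ (detVec_ne_zero hl₂))
  have halt : ∀ x, j₁ x ∈ alternating n (Fin k) := by
    intro x
    obtain ⟨u, rfl⟩ := exists_smul_highestVec _ x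
    rw [map_smul, hj₁def, embed_highestVec]
    refine smul_mem_of_lie_stable _ (fun y F hF => ?_) u (detVec_mem_alternating _)
    rw [ι_smul]
    exact act_mem_alternating _ hF
  obtain ⟨b, μ, hμ, hb⟩ := exists_basis_binaryOp hj₁ halt
  obtain ⟨K, hK⟩ := exists_binaryDominant_XDiag n
  obtain ⟨r, H⟩ := simpleCoinvariants_tensor rfl hj₁ halt hj₂ (embed_highestVec _ _ _) hK b hμ hb
  have hdec : IsIrreducibleDecomposition fun i => eigenLieSubmodule _ H.comm (2 * μ i + r) :=
    ⟨H.isIrreducible_eigenLieSubmodule, H.isInternal_eigenLieSubmodule⟩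
  refine ⟨binaryDominant n, isDominant_binaryDominant n, ⟨_, hdec⟩, ?_⟩
  -- By Schur's lemma every C_p acts by scalars on both factors and on each constituent, so all the
  -- operators M(C_p) act by scalars, as separation demands; only p = 2 is needed to distinguish the
  -- constituents.
  choose s₁ hs₁ using fun p => exists_scalar_of_isIrreducible (L := 𝔰𝔩 n)
    (envAction n (V (fundWeight n k)) (casimir n p)) (envAction_casimir_lie p)
  choose s₂ hs₂ using fun p => exists_scalar_of_isIrreducible (L := 𝔰𝔩 n)
    (envAction n (V (binaryDominant n)) (casimir n p)) (envAction_casimir_lie p)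
  have hex : ∀ i (p : ℕ), ∃ a : ℂ, ∀ t ∈ eigenLieSubmodule _ H.comm (2 * μ i + r),
      envAction n _ (casimir n p) t = a • t := fun i p =>
    have := hdec.irreducible i
    exists_scalar_on_of_isIrreducible _ _ (envAction_casimir_lie p) (envAction_mem _ _)
  choose a ha using hex
  refine ⟨_, _, fun i p => a i p - (s₁ p + s₂ p), hdec, fun i p t ht => ?_, fun i i' hii' => ?_⟩
  · rw [M_apply_of_scalars (hs₁ p) (hs₂ p), ha i p t ht, sub_smul]
  -- The shift by the scalars of the two factors is the same for all constituents, so equal values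
  -- of M(C_2) would give equal eigenvalues 2 μ i + r.
  · refine ⟨⟨2, Finset.mem_Icc.2 ⟨le_rfl, by omega⟩⟩, fun h => hii' (H.injective ?_)⟩
    have ha2 : ∀ i, a i 2 = 2 * μ i + r := by
      intro i
      have := hdec.irreducible i
      have hnt := LieModule.nontrivial_of_isIrreducible ℂ (𝔰𝔩 n)
        (eigenLieSubmodule _ H.comm (2 * μ i + r))
      obtain ⟨t, ht⟩ := exists_ne (0 : eigenLieSubmodule _ H.comm (2 * μ i + r))
      refine smul_left_injective ℂ (fun h => ht (Subtype.ext h)) ?_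
      exact (ha i 2 t t.2).symm.trans (mem_eigenLieSubmodule.1 t.2)
    simpa [ha2] using h
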